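/- **Theorem 4.2 (multilinear strong-type extrapolation).** For $1<r<\infty$, a weight $w\in A_r$ is a locally integrable, a.e. positive function on $\mathbb R^n$ with $$\|w\|_{A_r}=\sup_Q\Big(\frac1{|Q|}\int_Q w\Big)\Big(\frac1{|Q|}\int_Q w^{-1/(r-1)}\Big)^{r-1}<\infty,$$ where the supremum is over all cubes $Q\subset\mathbb R^n$ with sides parallel to the axes; for $0<r<\infty$, $\|f\|_{L^r(w)}=\big(\int_{\mathbb R^n}|f|^r w\,dx\big)^{1/r}\in[0,\infty]$. A function $\varphi:(0,\infty)^2\to[0,\infty)$ is called locally bounded if $\sup_{0<s,t<M}\varphi(s,t)<\infty$ for every $M>0$. In products, $0\cdot\infty=0$. Let $1<p_1,p_2<\infty$ and $1<q_1,q_2<\infty$, put $\frac1p=\frac1{p_1}+\frac1{p_2}$ and $\frac1q=\frac1{q_1}+\frac1{q_2}$, and let $\varphi$ be locally bounded. Then there is a locally bounded function $\Phi$, depending only on $n,p_1,p_2,q_1,q_2$ and $\varphi$, with the following property. Let $f_1,f_2,g:\mathbb R^n\to\mathbb C$ be measurable functions such that $$\|g\|_{L^p(u)}\le \varphi\big(\|u_1\|_{A_{p_1}},\|u_2\|_{A_{p_2}}\big)\,\|f_1\|_{L^{p_1}(u_1)}\,\|f_2\|_{L^{p_2}(u_2)},\qquad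 u=u_1^{p/p_1}u_2^{p/p_2},$$ for all $u_1\in A_{p_1}$ and $u_2\in A_{p_2}$. Then $$\|g\|_{L^q(w)}\le \Phi\big(\|w_1\|_{A_{q_1}},\|w_2\|_{A_{q_2}}\big)\,\|f_1\|_{L^{q_1}(w_1)}\,\|f_2\|_{L^{q_2}(w_2)},\qquad w=w_1^{q/q_1}w_2^{q/q_2},$$ for all $w_1\in A_{q_1}$ and $w_2\in A_{q_2}$. -/

import Mathlib

open MeasureTheory
open scoped ENNReal NNReal

namespace MultExtrap

/-- The closed cube in `ℝⁿ` with sides parallel to the axes, lower corner `a` and side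
length `ℓ`, i.e. the product of the intervals `[a i, a i + ℓ]`. -/
def cube {n : ℕ} (a : Fin n → ℝ) (ℓ : ℝ) : Set (Fin n → ℝ) :=
  {x | ∀ i, a i ≤ x i ∧ x i ≤ a i + ℓ}

/-- The Muckenhoupt characteristic (for `1 < r < ∞`), a supremum over all cubes,
`‖w‖_{A_r} = sup_Q (|Q|⁻¹ ∫_Q w) (|Q|⁻¹ ∫_Q w^{-1/(r-1)})^{r-1}`, with values in `[0, ∞]`. -/
noncomputable def apConst {n : ℕ} (r : ℝ) (w : (Fin n → ℝ) → ℝ) : ℝ≥0∞ :=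
  ⨆ (a : Fin n → ℝ) (ℓ : ℝ) (_ : 0 < ℓ),
    (⨍⁻ x in cube a ℓ, ENNReal.ofReal (w x) ∂volume) *
      (⨍⁻ x in cube a ℓ, ENNReal.ofReal (w x) ^ (-(1 / (r - 1))) ∂volume) ^ (r - 1)

/-- `w` is a Muckenhoupt `A_r` weight (for `1 < r < ∞`): a locally integrable, almost everywhere
positive function with finite characteristic. -/
structure IsApWeight {n : ℕ} (r : ℝ) (w : (Fin n → ℝ) → ℝ) : Prop where
  locallyIntegrable : LocallyIntegrable w
  pos : ∀ᵐ x, 0 < w x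
  apConst_lt_top : apConst r w < ∞

/-- The weighted (quasi-)norm `‖f‖_{L^r(w)} = (∫ |f|^r w dx)^{1/r}`, for `0 < r < ∞`,
with values in `[0, ∞]`. -/
noncomputable def weightedNorm {n : ℕ} (r : ℝ) (w : (Fin n → ℝ) → ℝ)
    (f : (Fin n → ℝ) → ℂ) : ℝ≥0∞ :=
  eLpNorm f (ENNReal.ofReal r) (volume.withDensity fun x => ENNReal.ofReal (w x))

/-- A function of two positive variables is locally bounded if it is bounded on each
`(0, M) × (0, M)`. -/
def IsLocallyBounded (φ : ℝ≥0 → ℝ≥0 → ℝ≥0) : Prop :=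
  ∀ M : ℝ≥0, ∃ C : ℝ≥0, ∀ s t : ℝ≥0, 0 < s → s < M → 0 < t → t < M → φ s t ≤ C

/-- The triple `(f₁, f₂, g)` satisfies
`‖g‖_{L^p(u)} ≤ φ(‖u₁‖_{A_{p₁}}, ‖u₂‖_{A_{p₂}}) ‖f₁‖_{L^{p₁}(u₁)} ‖f₂‖_{L^{p₂}(u₂)}`,
where `u = u₁^{p/p₁} u₂^{p/p₂}`, for all weights `u₁ ∈ A_{p₁}` and `u₂ ∈ A_{p₂}`. -/
def StrongBound {n : ℕ} (p₁ p₂ p : ℝ) (φ : ℝ≥0 → ℝ≥0 → ℝ≥0)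
    (f₁ f₂ g : (Fin n → ℝ) → ℂ) : Prop :=
  ∀ u₁ u₂ : (Fin n → ℝ) → ℝ, IsApWeight p₁ u₁ → IsApWeight p₂ u₂ →
    weightedNorm p (fun x => u₁ x ^ (p / p₁) * u₂ x ^ (p / p₂)) g ≤
      (φ (apConst p₁ u₁).toNNReal (apConst p₂ u₂).toNNReal : ℝ≥0∞) *
        weightedNorm p₁ u₁ f₁ * weightedNorm p₂ u₂ f₂

end MultExtrap

/-!
Multilinear extrapolation reduces to extrapolation in one variable at a time. With the second
weight `u₂` frozen, put `h = |g| u₂^{1/p₂}`; the hypothesis reads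
`‖h v^{1/p₁}‖_{L^p} ≤ C ‖f₁ v^{1/p₁}‖_{L^{p₁}}` for all `v ∈ A_{p₁}`, and `exists_normBound` replaces
`p₁` by `q₁` while keeping the gap `1/p - 1/p₁ = 1/p₂`. Freezing the first weight and moving the
second exponent in the same way gives the result (`exists_pairBound`). Nothing requires
`p, q ≥ 1`: the left exponents enter only through Hölder's inequality with a gap.

The one-variable step from `a` to `b` treats `w ∈ A_b` as follows. If `b < a`, the function `f` has a
majorant `U ∈ A_1` of comparable norm in `L^b(w)`, the weight `v = w U^{b - a}` belongs to `A_a`, and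
Hölder's inequality passes from `v` to `w` on the left, while `f ≤ U` does so on the right. If `a < b`,
the norm of `h w^{1/b}` is tested against a dual function; its power is majorized by some `U ∈ A_1`
in `L^{b'}(σ)` with `σ = w^{-1/(b-1)} ∈ A_{b'}`, and the dual of the previous construction
of weights (`apE_mul_rpow_neg_le` with `apE_dual_le`) produces `v ∈ A_a`.

The majorant comes from the Rubio de Francia algorithm (`exists_A1_majorant`), here as the least
solution of `U = F + ε M U`, with `M` the maximal operator and `ε` small. It needs Muckenhoupt's
theorem that `M` is bounded on `L^p(w)` uniformly over `w ∈ A_p` of bounded characteristic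
(`exists_centMax_weighted_bound`). Following Lerner, `(M F)^{p-1}` is dominated pointwise by
`M_w ((M_σ (F / σ))^{p-1} / w)`, where `M_w` and `M_σ` are the centred maximal operators of the measures
`w dx` and `σ dx`, `σ = w^{-1/(p-1)}`. By the Besicovitch covering theorem, centred maximal operators
are bounded on `L^p(μ)` with a constant that does not depend on the measure `μ`
(`exists_centMax_strong_type`), so no openness property of `A_p` classes is used.
-/

namespace MultExtrap

open Set Metric

/-! ### The centred maximal function of a measure -/

/-- The centred maximal function of `F` with respect to the measure `μ`: the supremum of the
`μ`-averages of `F` over the cubes centred at `x` whose half side length is an integer power of two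
(closed balls of the sup norm). Restricting to countably many radii costs a dimensional constant
and makes measurability immediate. Balls of measure `0` or `∞` contribute `0` to the supremum,
by the conventions `0 / 0 = 0` and `x / ∞ = 0`. -/
noncomputable def centMax {n : ℕ} (μ : Measure (Fin n → ℝ)) (F : (Fin n → ℝ) → ℝ≥0∞)
    (x : Fin n → ℝ) : ℝ≥0∞ :=
  ⨆ k : ℤ, (∫⁻ y in closedBall x ((2 : ℝ) ^ k), F y ∂μ) / μ (closedBall x ((2 : ℝ) ^ k))

variable {n : ℕ}

lemma measurable_setLIntegral_closedBall (μ : Measure (Fin n → ℝ)) [SFinite μ]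
    {F : (Fin n → ℝ) → ℝ≥0∞} (hF : Measurable F) (r : ℝ) :
    Measurable fun x => ∫⁻ y in closedBall x r, F y ∂μ := by
  have hset : MeasurableSet {z : (Fin n → ℝ) × (Fin n → ℝ) | dist z.2 z.1 ≤ r} :=
    measurableSet_le (measurable_snd.dist measurable_fst) measurable_const
  have h := (Measurable.indicator (hF.comp measurable_snd) hset).lintegral_prod_right' (ν := μ)
  convert h using 2 with x
  rw [← lintegral_indicator measurableSet_closedBall]
  rfl

lemma measurable_centMax (μ : Measure (Fin n → ℝ)) [SFinite μ]
    {F : (Fin n → ℝ) → ℝ≥0∞} (hF : Measurable F) : Measurable (centMax μ F) := by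
  refine Measurable.iSup fun k => (measurable_setLIntegral_closedBall μ hF _).div ?_
  simpa using measurable_setLIntegral_closedBall μ (F := 1) measurable_one ((2 : ℝ) ^ k)

lemma centMax_mono {μ : Measure (Fin n → ℝ)} {F G : (Fin n → ℝ) → ℝ≥0∞} (h : F ≤ G) :
    centMax μ F ≤ centMax μ G := fun _ =>
  iSup_mono fun _ => ENNReal.div_le_div_right (lintegral_mono fun y => h y) _

lemma le_centMax (μ : Measure (Fin n → ℝ)) (F : (Fin n → ℝ) → ℝ≥0∞) (x : Fin n → ℝ) (k : ℤ) :
    (∫⁻ y in closedBall x ((2 : ℝ) ^ k), F y ∂μ) / μ (closedBall x ((2 : ℝ) ^ k))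
      ≤ centMax μ F x :=
  le_iSup (fun k : ℤ => (∫⁻ y in closedBall x ((2 : ℝ) ^ k), F y ∂μ) /
    μ (closedBall x ((2 : ℝ) ^ k))) k

/-- Centred maximal functions commute with increasing limits. -/
lemma centMax_iSup (μ : Measure (Fin n → ℝ)) {S : ℕ → (Fin n → ℝ) → ℝ≥0∞}
    (hS : ∀ i, Measurable (S i)) (hm : Monotone S) (x : Fin n → ℝ) :
    centMax μ (fun y => ⨆ i, S i y) x = ⨆ i, centMax μ (S i) x := by
  unfold centMax
  rw [iSup_comm]
  congr 1 with k
  rw [lintegral_iSup hS hm, ENNReal.iSup_div]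

/-- Besicovitch selection: a set of centres of balls of bounded radius on each of which
`c * μ B ≤ ∫_B G` has measure at most `N c⁻¹ ∫ G`, with `N` a dimensional constant. -/
lemma exists_besicovitch_weak_bound (n : ℕ) : ∃ N : ℕ, ∀ (μ : Measure (Fin n → ℝ))
    (G : (Fin n → ℝ) → ℝ≥0∞) (c : ℝ≥0∞) (A : Set (Fin n → ℝ)) (r : (Fin n → ℝ) → ℝ) (R : ℝ),
    (∀ x ∈ A, 0 < r x ∧ r x ≤ R ∧ c * μ (closedBall x (r x)) ≤ ∫⁻ y in closedBall x (r x), G y ∂μ) →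
      c * μ A ≤ N * ∫⁻ y, G y ∂μ := by
  obtain ⟨N, τ, hτ, hN⟩ :=
    HasBesicovitchCovering.no_satelliteConfig (α := Fin n → ℝ)
  refine ⟨N, fun μ G c A r R h => ?_⟩
  let q : Besicovitch.BallPackage A (Fin n → ℝ) :=
    { c := fun x => x
      r := fun x => r x
      rpos := fun x => (h x x.2).1
      r_bound := R
      r_le := fun x => (h x x.2).2.1 }
  obtain ⟨s, hs, hcov⟩ := Besicovitch.exist_disjoint_covering_families hτ hN q
  have hcount : ∀ i, (s i).Countable := fun i =>
    (hs i).countable_of_nonempty_interior fun j _ =>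
      ⟨q.c j, ball_subset_interior_closedBall (mem_ball_self (q.rpos j))⟩
  have hA : A ⊆ ⋃ i : Fin N, ⋃ j ∈ s i, closedBall (q.c j) (q.r j) := by
    intro x hx
    have := hcov ⟨⟨x, hx⟩, rfl⟩
    simp only [mem_iUnion] at this ⊢
    obtain ⟨i, j, hj, hx'⟩ := this
    exact ⟨i, j, hj, ball_subset_closedBall hx'⟩
  calc c * μ A ≤ c * ∑ i : Fin N, μ (⋃ j ∈ s i, closedBall (q.c j) (q.r j)) := by
        gcongr
        exact (measure_mono hA).trans (measure_iUnion_fintype_le _ _)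
    _ = ∑ i : Fin N, c * μ (⋃ j ∈ s i, closedBall (q.c j) (q.r j)) := Finset.mul_sum _ _ _
    _ ≤ ∑ i : Fin N, ∫⁻ y, G y ∂μ := by
        refine Finset.sum_le_sum fun i _ => ?_
        rw [measure_biUnion (hcount i) (hs i) fun j _ => measurableSet_closedBall,
          ← ENNReal.tsum_mul_left]
        calc _ ≤ ∑' j : s i, ∫⁻ y in closedBall (q.c j) (q.r j), G y ∂μ :=
              ENNReal.tsum_le_tsum fun j => (h j.1 j.1.2).2.2
          _ = ∫⁻ y in ⋃ j ∈ s i, closedBall (q.c j) (q.r j), G y ∂μ :=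
              (lintegral_biUnion (hcount i) (fun j _ => measurableSet_closedBall) (hs i) _).symm
          _ ≤ _ := setLIntegral_le_lintegral _ _
    _ = N * ∫⁻ y, G y ∂μ := by simp

/-- The weak-type estimate for the centred maximal function, already truncated: only the part of
`F` above height `t / 2` contributes to the level set at height `t`. -/
lemma exists_centMax_weak_type (n : ℕ) : ∃ N : ℕ, ∀ (μ : Measure (Fin n → ℝ))
    (F : (Fin n → ℝ) → ℝ≥0∞), Measurable F → ∀ t : ℝ≥0∞, t ≠ ∞ →
      t / 2 * μ {x | t < centMax μ F x} ≤ N * ∫⁻ y in {y | t / 2 < F y}, F y ∂μ := by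
  obtain ⟨N, hN⟩ := exists_besicovitch_weak_bound n
  refine ⟨N, fun μ F hF t ht => ?_⟩
  have hset : MeasurableSet {y | t / 2 < F y} := measurableSet_lt measurable_const hF
  let A : ℕ → Set (Fin n → ℝ) := fun K => {x | ∃ k : ℤ, k ≤ K ∧
    t < (∫⁻ y in closedBall x ((2 : ℝ) ^ k), F y ∂μ) / μ (closedBall x ((2 : ℝ) ^ k))}
  have hAmono : Monotone A := by
    rintro K L hKL x ⟨k, hk, hx⟩
    exact ⟨k, hk.trans (by exact_mod_cast hKL), hx⟩
  have hU : {x | t < centMax μ F x} = ⋃ K, A K := by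
    ext x
    simp only [mem_ofPred_eq, centMax, lt_iSup_iff, mem_iUnion, A]
    constructor
    · rintro ⟨k, hk⟩
      exact ⟨k.toNat, k, Int.self_le_toNat k, hk⟩
    · rintro ⟨_, k, _, hk⟩
      exact ⟨k, hk⟩
  rw [hU, hAmono.measure_iUnion, ENNReal.mul_iSup, ← lintegral_indicator hset]
  refine iSup_le fun K => ?_
  choose! k hk using fun x (hx : x ∈ A K) => hx
  refine hN μ _ (t / 2) (A K) (fun x => (2 : ℝ) ^ k x) ((2 : ℝ) ^ (K : ℤ)) fun x hx =>
    ⟨by positivity, zpow_le_zpow_right₀ one_le_two (hk x hx).1, ?_⟩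
  have hlt := (hk x hx).2
  set B := closedBall x ((2 : ℝ) ^ k x)
  have hB : μ B ≠ ∞ := by
    intro h
    rw [h, ENNReal.div_top] at hlt
    exact not_lt_zero hlt
  have h1 : t * μ B ≤ ∫⁻ y in B, F y ∂μ := ENNReal.mul_le_of_le_div hlt.le
  have h2 : ∫⁻ y in B, F y ∂μ ≤
      (∫⁻ y in B, {y | t / 2 < F y}.indicator F y ∂μ) + t / 2 * μ B := by
    calc ∫⁻ y in B, F y ∂μ ≤ ∫⁻ y in B, ({y | t / 2 < F y}.indicator F y + t / 2) ∂μ := by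
          refine lintegral_mono fun y => ?_
          by_cases hy : t / 2 < F y
          · simp [indicator, hy]
          · simpa only [indicator, mem_ofPred_eq, hy, if_false, zero_add] using not_lt.1 hy
      _ = _ := by rw [lintegral_add_right _ measurable_const]; simp
  have h3 : t / 2 * μ B + t / 2 * μ B ≤
      (∫⁻ y in B, {y | t / 2 < F y}.indicator F y ∂μ) + t / 2 * μ B := by
    rw [← add_mul, ENNReal.add_halves]
    exact h1.trans h2
  exact (ENNReal.add_le_add_iff_right
    (ENNReal.mul_ne_top (ENNReal.div_ne_top ht two_ne_zero) hB)).1 h3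

/-- Layer-cake inequality for functions with values in `[0, ∞]`. -/
lemma lintegral_rpow_le_lintegral_meas_lt_mul {α : Type*} [MeasurableSpace α] (μ : Measure α)
    {G : α → ℝ≥0∞} (hG : Measurable G) {p : ℝ} (hp : 0 < p) :
    ∫⁻ x, G x ^ p ∂μ ≤ ENNReal.ofReal p *
      ∫⁻ t in Ioi (0 : ℝ), μ {x | ENNReal.ofReal t < G x} * ENNReal.ofReal (t ^ (p - 1)) := by
  have hsup : ∀ x, G x ^ p = ⨆ m : ℕ, (min (G x) m) ^ p := by
    intro x
    have h1 : G x = ⨆ m : ℕ, min (G x) m := by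
      rw [← inf_iSup_eq, ENNReal.iSup_natCast, inf_top_eq]
    conv_lhs => rw [h1]
    exact (ENNReal.orderIsoRpow p hp).map_iSup _
  simp_rw [hsup]
  rw [lintegral_iSup (fun m => (hG.min measurable_const).pow_const p)]
  swap
  · intro m l hml x
    exact ENNReal.rpow_le_rpow (min_le_min_left _ (by exact_mod_cast hml)) hp.le
  refine iSup_le fun m => ?_
  have hfin : ∀ x, min (G x) m ≠ ∞ := fun x =>
    ne_top_of_le_ne_top (ENNReal.natCast_ne_top m) (min_le_right _ _)
  have h := lintegral_rpow_eq_lintegral_meas_lt_mul μ (f := fun x => (min (G x) m).toReal)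
    (Filter.Eventually.of_forall fun x => ENNReal.toReal_nonneg)
    (hG.min measurable_const).ennreal_toReal.aemeasurable hp
  have h' : ∀ x, ENNReal.ofReal ((min (G x) m).toReal ^ p) = (min (G x) m) ^ p := by
    intro x
    rw [← ENNReal.ofReal_rpow_of_nonneg ENNReal.toReal_nonneg hp.le, ENNReal.ofReal_toReal (hfin x)]
  simp_rw [h'] at h
  rw [h]
  refine mul_le_mul_right ?_ _
  refine setLIntegral_mono_ae' measurableSet_Ioi (Filter.Eventually.of_forall fun t ht => ?_)
  gcongr with x
  intro hx
  exact ((ENNReal.ofReal_lt_iff_lt_toReal (le_of_lt ht) (hfin _)).2 hx).trans_le (min_le_left _ _)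

lemma lintegral_Ioo_rpow {T s : ℝ} (hT : 0 ≤ T) (hs : -1 < s) :
    ∫⁻ t in Ioo 0 T, ENNReal.ofReal (t ^ s) = ENNReal.ofReal (T ^ (s + 1) / (s + 1)) := by
  rw [setLIntegral_congr Ioo_ae_eq_Ioc, ← ofReal_integral_eq_lintegral_ofReal]
  · rw [← intervalIntegral.integral_of_le hT, integral_rpow (Or.inl hs),
      Real.zero_rpow (by linarith), sub_zero]
  · exact (intervalIntegrable_iff_integrableOn_Ioc_of_le hT).1
      (intervalIntegral.intervalIntegrable_rpow' hs)
  · filter_upwards [ae_restrict_mem measurableSet_Ioc] with t ht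
    exact Real.rpow_nonneg ht.1.le _

/-- The centred maximal function with respect to an arbitrary (s-finite) measure `μ` is bounded on
`L^p(μ)` for `p > 1`, with a constant that depends only on the dimension and `p`. -/
lemma exists_centMax_strong_type (n : ℕ) {p : ℝ} (hp : 1 < p) : ∃ K : ℝ≥0∞, K ≠ ∞ ∧
    ∀ (μ : Measure (Fin n → ℝ)) [SFinite μ] (F : (Fin n → ℝ) → ℝ≥0∞), Measurable F →
      ∫⁻ x, centMax μ F x ^ p ∂μ ≤ K * ∫⁻ x, F x ^ p ∂μ := by
  obtain ⟨N, hN⟩ := exists_centMax_weak_type n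
  have hp1 : 0 < p - 1 := by linarith
  refine ⟨ENNReal.ofReal p * (2 * N * ENNReal.ofReal (2 ^ (p - 1) / (p - 1))), by finiteness,
    fun μ _ F hF => ?_⟩
  have hjoint : Measurable fun z : ℝ × (Fin n → ℝ) =>
      {z : ℝ × (Fin n → ℝ) | ENNReal.ofReal z.1 < 2 * F z.2}.indicator
        (fun z => F z.2 * ENNReal.ofReal (z.1 ^ (p - 2))) z := by
    refine Measurable.indicator (by fun_prop) (measurableSet_lt (by fun_prop) (by fun_prop))
  calc ∫⁻ x, centMax μ F x ^ p ∂μ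
      ≤ ENNReal.ofReal p * ∫⁻ t in Ioi (0 : ℝ),
          μ {x | ENNReal.ofReal t < centMax μ F x} * ENNReal.ofReal (t ^ (p - 1)) :=
        lintegral_rpow_le_lintegral_meas_lt_mul μ (measurable_centMax μ hF) (by linarith)
    _ ≤ ENNReal.ofReal p * ∫⁻ t in Ioi (0 : ℝ), 2 * N * ∫⁻ x,
          {z : ℝ × (Fin n → ℝ) | ENNReal.ofReal z.1 < 2 * F z.2}.indicator
            (fun z => F z.2 * ENNReal.ofReal (z.1 ^ (p - 2))) (t, x) ∂μ := by
        refine mul_le_mul_right ?_ _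
        refine setLIntegral_mono_ae' measurableSet_Ioi (Filter.Eventually.of_forall fun t ht => ?_)
        have ht0 : (0 : ℝ) < t := ht
        have hset : MeasurableSet {y | ENNReal.ofReal t / 2 < F y} :=
          measurableSet_lt measurable_const hF
        have hiff : ∀ y, ENNReal.ofReal t / 2 < F y ↔ ENNReal.ofReal t < 2 * F y := by
          intro y
          rw [ENNReal.div_lt_iff (Or.inl two_ne_zero) (Or.inl ENNReal.ofNat_ne_top), mul_comm]
        have hpow : ENNReal.ofReal (t ^ (p - 1)) =
            2 * (ENNReal.ofReal t / 2) * ENNReal.ofReal (t ^ (p - 2)) := by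
          rw [ENNReal.mul_div_cancel two_ne_zero ENNReal.ofNat_ne_top, ← ENNReal.ofReal_mul ht0.le]
          congr 1
          nth_rewrite 2 [← Real.rpow_one t]
          rw [← Real.rpow_add ht0]
          congr 1
          ring
        have hind : ∫⁻ x, {z : ℝ × (Fin n → ℝ) | ENNReal.ofReal z.1 < 2 * F z.2}.indicator
            (fun z => F z.2 * ENNReal.ofReal (z.1 ^ (p - 2))) (t, x) ∂μ =
            (∫⁻ y in {y | ENNReal.ofReal t / 2 < F y}, F y ∂μ) * ENNReal.ofReal (t ^ (p - 2)) := by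
          rw [← lintegral_mul_const _ hF, ← lintegral_indicator hset]
          congr 1 with y
          simp only [indicator, mem_ofPred_eq, hiff]
        rw [hind, hpow]
        calc _ = 2 * ENNReal.ofReal (t ^ (p - 2)) *
              (ENNReal.ofReal t / 2 * μ {x | ENNReal.ofReal t < centMax μ F x}) := by ring
          _ ≤ 2 * ENNReal.ofReal (t ^ (p - 2)) *
              (N * ∫⁻ y in {y | ENNReal.ofReal t / 2 < F y}, F y ∂μ) := by
                exact mul_le_mul_right (hN μ F hF _ ENNReal.ofReal_ne_top) _
          _ = _ := by ring
    _ = ENNReal.ofReal p * (2 * N * ∫⁻ x, (∫⁻ t in Ioi (0 : ℝ),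
          {z : ℝ × (Fin n → ℝ) | ENNReal.ofReal z.1 < 2 * F z.2}.indicator
            (fun z => F z.2 * ENNReal.ofReal (z.1 ^ (p - 2))) (t, x)) ∂μ) := by
        rw [lintegral_const_mul' _ _ (by finiteness), lintegral_lintegral_swap]
        exact hjoint.aemeasurable
    _ ≤ ENNReal.ofReal p * (2 * N * ∫⁻ x,
          ENNReal.ofReal (2 ^ (p - 1) / (p - 1)) * F x ^ p ∂μ) := by
        gcongr with x
        by_cases hx : F x = ∞
        · rw [hx, ENNReal.top_rpow_of_pos (by linarith), ENNReal.mul_top]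
          · exact le_top
          · simp only [ne_eq, ENNReal.ofReal_eq_zero, not_le]
            positivity
        obtain ⟨T, hT0, hT⟩ : ∃ T : ℝ, 0 ≤ T ∧ F x = ENNReal.ofReal T :=
          ⟨(F x).toReal, ENNReal.toReal_nonneg, (ENNReal.ofReal_toReal hx).symm⟩
        have hle : ∀ t : ℝ, {z : ℝ × (Fin n → ℝ) | ENNReal.ofReal z.1 < 2 * F z.2}.indicator
            (fun z => F z.2 * ENNReal.ofReal (z.1 ^ (p - 2))) (t, x) ≤
            (Iio (2 * T)).indicator (fun t => F x * ENNReal.ofReal (t ^ (p - 2))) t := by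
          intro t
          simp only [indicator, mem_ofPred_eq, mem_Iio]
          split_ifs with h1 h2
          · exact le_rfl
          · exfalso
            apply h2
            rw [hT, ← ENNReal.ofReal_ofNat, ← ENNReal.ofReal_mul (by norm_num)] at h1
            exact (ENNReal.ofReal_lt_ofReal_iff'.1 h1).1
          · exact zero_le
          · exact le_rfl
        calc _ ≤ ∫⁻ t in Ioi (0 : ℝ),
              (Iio (2 * T)).indicator (fun t => F x * ENNReal.ofReal (t ^ (p - 2))) t :=
              lintegral_mono hle
          _ = ∫⁻ t in Ioo 0 (2 * T), F x * ENNReal.ofReal (t ^ (p - 2)) := by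
              rw [setLIntegral_indicator measurableSet_Iio, Iio_inter_Ioi]
          _ = F x * ENNReal.ofReal ((2 * T) ^ (p - 1) / (p - 1)) := by
              rw [lintegral_const_mul' _ _ hx, lintegral_Ioo_rpow (by positivity) (by linarith)]
              rw [show p - 2 + 1 = p - 1 by ring]
          _ = _ := by
              rw [hT, ENNReal.ofReal_rpow_of_nonneg hT0 (by linarith), ← ENNReal.ofReal_mul hT0,
                ← ENNReal.ofReal_mul (by positivity), Real.mul_rpow (by norm_num) hT0]
              congr 1
              have : T ^ p = T * T ^ (p - 1) := by
                rw [← Real.rpow_one_add' hT0 (by linarith)]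
                congr 1
                ring
              rw [this]
              ring
          _ ≤ _ := le_rfl
    _ = _ := by
        rw [lintegral_const_mul' _ _ ENNReal.ofReal_ne_top]
        ring

/-! ### Extended nonnegative weights and their Muckenhoupt characteristic -/

/-- The Muckenhoupt characteristic of a weight with values in `[0, ∞]`; it agrees with `apConst`
on `fun x => ENNReal.ofReal (w x)`. -/
noncomputable def apE (r : ℝ) (w : (Fin n → ℝ) → ℝ≥0∞) : ℝ≥0∞ :=
  ⨆ (a : Fin n → ℝ) (ℓ : ℝ) (_ : 0 < ℓ),
    (⨍⁻ x in cube a ℓ, w x ∂volume) *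
      (⨍⁻ x in cube a ℓ, w x ^ (-(1 / (r - 1))) ∂volume) ^ (r - 1)

/-- A weight with values in `[0, ∞]`: measurable, and positive and finite almost everywhere.
Local integrability is not required, since it follows from a finite characteristic. -/
structure IsWeight (w : (Fin n → ℝ) → ℝ≥0∞) : Prop where
  aemeasurable : AEMeasurable w
  ae_ne : ∀ᵐ x, w x ≠ 0 ∧ w x ≠ ∞

lemma cube_eq_Icc (a : Fin n → ℝ) (ℓ : ℝ) : cube a ℓ = Icc a (fun i => a i + ℓ) := by
  ext x
  simp [cube, Set.mem_Icc, Pi.le_def, forall_and]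

lemma measurableSet_cube (a : Fin n → ℝ) (ℓ : ℝ) : MeasurableSet (cube a ℓ) := by
  rw [cube_eq_Icc]
  exact measurableSet_Icc

lemma volume_cube (a : Fin n → ℝ) (ℓ : ℝ) : volume (cube a ℓ) = ENNReal.ofReal ℓ ^ n := by
  rw [cube_eq_Icc, Real.volume_Icc_pi]
  simp

lemma volume_cube_ne_zero (a : Fin n → ℝ) {ℓ : ℝ} (hℓ : 0 < ℓ) : volume (cube a ℓ) ≠ 0 := by
  rw [volume_cube]
  exact pow_ne_zero _ (by simpa using hℓ)

lemma volume_cube_ne_top (a : Fin n → ℝ) (ℓ : ℝ) : volume (cube a ℓ) ≠ ∞ := by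
  rw [volume_cube]
  finiteness

lemma closedBall_eq_cube (x : Fin n → ℝ) {r : ℝ} (hr : 0 ≤ r) :
    closedBall x r = cube (fun i => x i - r) (2 * r) := by
  ext y
  simp only [mem_closedBall, dist_pi_le_iff hr, cube, mem_ofPred_eq, Real.dist_eq, abs_le]
  refine forall_congr' fun i => ⟨fun h => ⟨?_, ?_⟩, fun h => ⟨?_, ?_⟩⟩ <;> linarith [h.1, h.2]

lemma cube_subset_closedBall {a x : Fin n → ℝ} {ℓ r : ℝ} (hr : ℓ ≤ r) (hr0 : 0 ≤ r)
    (hx : x ∈ cube a ℓ) : cube a ℓ ⊆ closedBall x r := by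
  intro y hy
  rw [mem_closedBall, dist_pi_le_iff hr0]
  intro i
  rw [Real.dist_eq, abs_le]
  constructor <;> linarith [hx i, hy i]

lemma apE_congr {r : ℝ} {v w : (Fin n → ℝ) → ℝ≥0∞} (h : v =ᵐ[volume] w) : apE r v = apE r w := by
  unfold apE
  congr! 6 with a ℓ hℓ
  · exact laverage_congr (ae_restrict_of_ae h)
  · congr 1
    refine laverage_congr (ae_restrict_of_ae ?_)
    filter_upwards [h] with x hx
    rw [hx]

lemma le_apE (r : ℝ) (w : (Fin n → ℝ) → ℝ≥0∞) (a : Fin n → ℝ) {ℓ : ℝ} (hℓ : 0 < ℓ) :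
    (⨍⁻ x in cube a ℓ, w x ∂volume) *
      (⨍⁻ x in cube a ℓ, w x ^ (-(1 / (r - 1))) ∂volume) ^ (r - 1) ≤ apE r w :=
  le_iSup_of_le a (le_iSup_of_le ℓ (le_iSup_of_le hℓ le_rfl))

lemma setLAverage_cube_ne_zero {w : (Fin n → ℝ) → ℝ≥0∞} (hw : AEMeasurable w)
    (hw0 : ∀ᵐ x, w x ≠ 0) (a : Fin n → ℝ) {ℓ : ℝ} (hℓ : 0 < ℓ) :
    ⨍⁻ x in cube a ℓ, w x ∂volume ≠ 0 := by
  rw [setLAverage_eq]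
  refine ENNReal.div_ne_zero.2 ⟨fun h => ?_, volume_cube_ne_top a ℓ⟩
  rw [lintegral_eq_zero_iff' hw.restrict] at h
  have : ∀ᵐ _x ∂(volume.restrict (cube a ℓ)), False := by
    filter_upwards [h, ae_restrict_of_ae hw0] with x h1 h2 using h2 h1
  rw [ae_iff] at this
  simp only [not_false_eq_true, ofPred_true, Measure.restrict_apply_univ] at this
  exact volume_cube_ne_zero a hℓ this

namespace IsWeight

variable {w : (Fin n → ℝ) → ℝ≥0∞}

lemma rpow (hw : IsWeight w) (s : ℝ) : IsWeight fun x => w x ^ s where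
  aemeasurable := hw.aemeasurable.pow_const s
  ae_ne := by
    filter_upwards [hw.ae_ne] with x hx
    exact ⟨(ENNReal.rpow_pos (pos_iff_ne_zero.2 hx.1) hx.2).ne',
      ENNReal.rpow_ne_top_of_ne_zero hx.1 hx.2⟩

lemma mul {v : (Fin n → ℝ) → ℝ≥0∞} (hw : IsWeight w) (hv : IsWeight v) :
    IsWeight fun x => w x * v x where
  aemeasurable := hw.aemeasurable.mul hv.aemeasurable
  ae_ne := by
    filter_upwards [hw.ae_ne, hv.ae_ne] with x hx hy
    exact ⟨mul_ne_zero hx.1 hy.1, ENNReal.mul_ne_top hx.2 hy.2⟩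

lemma setLAverage_ne_zero (hw : IsWeight w) (a : Fin n → ℝ) {ℓ : ℝ} (hℓ : 0 < ℓ) :
    ⨍⁻ x in cube a ℓ, w x ∂volume ≠ 0 :=
  setLAverage_cube_ne_zero hw.aemeasurable (hw.ae_ne.mono fun _ h => h.1) a hℓ

lemma apE_ne_zero (hw : IsWeight w) {r : ℝ} (hr : 1 < r) : apE r w ≠ 0 := by
  refine (lt_of_lt_of_le ?_ (le_apE r w 0 one_pos)).ne'
  refine ENNReal.mul_pos (hw.setLAverage_ne_zero 0 one_pos) ?_
  rw [Ne, ENNReal.rpow_eq_zero_iff_of_pos (by linarith)]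
  exact (hw.rpow _).setLAverage_ne_zero 0 one_pos

lemma setLAverage_ne_top (hw : IsWeight w) {r : ℝ} (hr : 1 < r) (h : apE r w ≠ ∞) (a : Fin n → ℝ)
    {ℓ : ℝ} (hℓ : 0 < ℓ) : ⨍⁻ x in cube a ℓ, w x ∂volume ≠ ∞ := by
  intro htop
  apply h
  rw [eq_top_iff]
  refine le_trans ?_ (le_apE r w a hℓ)
  rw [htop, ENNReal.top_mul]
  rw [Ne, ENNReal.rpow_eq_zero_iff_of_pos (by linarith)]
  exact (hw.rpow _).setLAverage_ne_zero a hℓ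

lemma setLAverage_rpow_ne_top (hw : IsWeight w) {r : ℝ} (hr : 1 < r) (h : apE r w ≠ ∞)
    (a : Fin n → ℝ) {ℓ : ℝ} (hℓ : 0 < ℓ) :
    ⨍⁻ x in cube a ℓ, w x ^ (-(1 / (r - 1))) ∂volume ≠ ∞ := by
  intro htop
  apply h
  rw [eq_top_iff]
  refine le_trans ?_ (le_apE r w a hℓ)
  rw [htop, ENNReal.top_rpow_of_pos (by linarith), ENNReal.mul_top]
  exact hw.setLAverage_ne_zero a hℓ

end IsWeight

/-- The characteristic in terms of integrals instead of averages. -/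
lemma setLIntegral_mul_rpow_le_apE {r : ℝ} (hr : 1 < r) (w : (Fin n → ℝ) → ℝ≥0∞)
    (a : Fin n → ℝ) {ℓ : ℝ} (hℓ : 0 < ℓ) :
    (∫⁻ x in cube a ℓ, w x) * (∫⁻ x in cube a ℓ, w x ^ (-(1 / (r - 1)))) ^ (r - 1) ≤
      apE r w * volume (cube a ℓ) ^ r := by
  have h0 := volume_cube_ne_zero a hℓ
  have h1 := volume_cube_ne_top a ℓ
  have h2 : volume (cube a ℓ) ^ r = volume (cube a ℓ) * volume (cube a ℓ) ^ (r - 1) := by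
    conv_lhs => rw [show r = 1 + (r - 1) by ring]
    rw [ENNReal.rpow_add _ _ h0 h1, ENNReal.rpow_one]
  rw [← measure_mul_setLAverage (f := w) h1,
    ← measure_mul_setLAverage (f := fun x => w x ^ (-(1 / (r - 1)))) h1,
    ENNReal.mul_rpow_of_nonneg _ _ (by linarith : 0 ≤ r - 1), h2]
  calc _ = ((⨍⁻ x in cube a ℓ, w x ∂volume) *
        (⨍⁻ x in cube a ℓ, w x ^ (-(1 / (r - 1))) ∂volume) ^ (r - 1)) *
        (volume (cube a ℓ) * volume (cube a ℓ) ^ (r - 1)) := by ring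
    _ ≤ _ := by gcongr; exact le_apE r w a hℓ

/-- Duality: if `w ∈ A_r`, then `w ^ (-1 / (r - 1)) ∈ A_{r'}`, with `r' = r / (r - 1)`. -/
lemma apE_dual_le {r : ℝ} (hr : 1 < r) (w : (Fin n → ℝ) → ℝ≥0∞) :
    apE (r / (r - 1)) (fun x => w x ^ (-(1 / (r - 1)))) ≤ apE r w ^ (1 / (r - 1)) := by
  have hr1 : 0 < r - 1 := by linarith
  have hd : r / (r - 1) - 1 = 1 / (r - 1) := by field_simp; ring
  refine iSup_le fun a => iSup_le fun ℓ => iSup_le fun hℓ => ?_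
  rw [hd]
  have h : ∀ x, (w x ^ (-(1 / (r - 1)))) ^ (-(1 / (1 / (r - 1)))) = w x := by
    intro x
    rw [← ENNReal.rpow_mul, show -(1 / (r - 1)) * -(1 / (1 / (r - 1))) = 1 by field_simp,
      ENNReal.rpow_one]
  simp_rw [h]
  calc _ = ((⨍⁻ x in cube a ℓ, w x ∂volume) *
        (⨍⁻ x in cube a ℓ, w x ^ (-(1 / (r - 1))) ∂volume) ^ (r - 1)) ^ (1 / (r - 1)) := by
        rw [ENNReal.mul_rpow_of_nonneg _ _ (by positivity), ← ENNReal.rpow_mul,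
          show (r - 1) * (1 / (r - 1)) = 1 by field_simp, ENNReal.rpow_one, mul_comm]
    _ ≤ _ := by gcongr; exact le_apE r w a hℓ

/-! ### The weighted maximal theorem -/

/-- Pointwise domination of the maximal function by a composition of two weighted maximal functions
with respect to the measures `w dx` and `w ^ (-1 / (p - 1)) dx`. The point is that for
`y ∈ Q(x, r)` one has `Q(x, r) ⊆ Q(y, 2r) ⊆ Q(x, 4r)`, so the average over `Q(x, r)` is controlled by
the maximal function centred at any such `y`. -/
lemma centMax_volume_rpow_le {p : ℝ} (hp : 1 < p) {w : (Fin n → ℝ) → ℝ≥0∞} (hwm : Measurable w)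
    (hw : IsWeight w) (hM : apE p w ≠ ∞) {F : (Fin n → ℝ) → ℝ≥0∞} (hF : Measurable F)
    (x : Fin n → ℝ) :
    centMax volume F x ^ (p - 1) ≤ apE p w * ((4 : ℝ≥0∞) ^ n) ^ p *
      centMax (volume.withDensity w) (fun y => centMax (volume.withDensity fun z =>
        w z ^ (-(1 / (p - 1)))) (fun z => F z / w z ^ (-(1 / (p - 1)))) y ^ (p - 1) / w y) x := by
  have hp1 : 0 < p - 1 := by linarith
  set σ : (Fin n → ℝ) → ℝ≥0∞ := fun z => w z ^ (-(1 / (p - 1))) with hσ_def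
  have hσm : Measurable σ := hwm.pow_const _
  have hσ : IsWeight σ := hw.rpow _
  set μ := volume.withDensity w
  set ν := volume.withDensity σ
  set G := centMax ν (fun z => F z / σ z) with hG_def
  have hGm : Measurable G := measurable_centMax ν (hF.div hσm)
  set H : (Fin n → ℝ) → ℝ≥0∞ := fun y => G y ^ (p - 1) / w y with hH_def
  have hHm : Measurable H := (hGm.pow_const _).div hwm
  rw [← ENNReal.le_rpow_inv_iff hp1]
  refine iSup_le fun k => ?_
  rw [ENNReal.le_rpow_inv_iff hp1]
  set Q := closedBall x ((2 : ℝ) ^ k) with hQ_def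
  set Q' := closedBall x ((2 : ℝ) ^ (k + 2)) with hQ'_def
  have hk : (0 : ℝ) < 2 ^ k := by positivity
  have hk1 : (2 : ℝ) ^ (k + 1) = 2 * 2 ^ k := by rw [zpow_add₀ two_ne_zero]; ring
  have hk2 : (2 : ℝ) ^ (k + 2) = 4 * 2 ^ k := by rw [zpow_add₀ two_ne_zero]; norm_num; ring
  have hQc : Q = cube (fun i => x i - 2 ^ k) (2 * 2 ^ k) := closedBall_eq_cube x hk.le
  have hQc' : Q' = cube (fun i => x i - 2 ^ (k + 2)) (2 * 2 ^ (k + 2)) :=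
    closedBall_eq_cube x (by positivity)
  have hQm : MeasurableSet Q := measurableSet_closedBall
  have hQQ' : Q ⊆ Q' := closedBall_subset_closedBall (by rw [hk2]; linarith)
  have hV0 : volume Q ≠ 0 := by rw [hQc]; exact volume_cube_ne_zero _ (by positivity)
  have hVt : volume Q ≠ ∞ := by rw [hQc]; exact volume_cube_ne_top _ _
  have hV' : volume Q' = 4 ^ n * volume Q := by
    rw [hQc, hQc', volume_cube, volume_cube, hk2, ← mul_pow]
    congr 1
    rw [← ENNReal.ofReal_ofNat 4, ← ENNReal.ofReal_mul (by norm_num)]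
    congr 1
    ring
  have hVt' : volume Q' ≠ ∞ := by rw [hQc']; exact volume_cube_ne_top _ _
  have hμQ : μ Q = ∫⁻ y in Q, w y := withDensity_apply _ hQm
  have hμQ' : μ Q' = ∫⁻ y in Q', w y := withDensity_apply _ measurableSet_closedBall
  have hνQ' : ν Q' = ∫⁻ y in Q', σ y := withDensity_apply _ measurableSet_closedBall
  have hA : μ Q * ν Q' ^ (p - 1) ≤ apE p w * ((4 : ℝ≥0∞) ^ n) ^ p * volume Q ^ p := by
    calc μ Q * ν Q' ^ (p - 1) ≤ μ Q' * ν Q' ^ (p - 1) := by gcongr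
      _ ≤ apE p w * volume Q' ^ p := by
          rw [hμQ', hνQ', hQc']
          exact setLIntegral_mul_rpow_le_apE hp w _ (by positivity)
      _ = _ := by rw [hV', ENNReal.mul_rpow_of_nonneg _ _ (by linarith : 0 ≤ p), mul_assoc]
  have hμ0 : μ Q ≠ 0 := by
    rw [hμQ, ← measure_mul_setLAverage (f := w) hVt, hQc]
    exact mul_ne_zero (volume_cube_ne_zero _ (by positivity))
      (hw.setLAverage_ne_zero _ (by positivity))
  have hμt : μ Q ≠ ∞ := by
    rw [hμQ, ← measure_mul_setLAverage (f := w) hVt, hQc]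
    exact ENNReal.mul_ne_top (volume_cube_ne_top _ _) (hw.setLAverage_ne_top hp hM _ (by positivity))
  have hν0 : ν Q' ≠ 0 := by
    rw [hνQ', ← measure_mul_setLAverage (f := σ) hVt', hQc']
    exact mul_ne_zero (volume_cube_ne_zero _ (by positivity))
      (hσ.setLAverage_ne_zero _ (by positivity))
  have hνt : ν Q' ≠ ∞ := by
    rw [hνQ', ← measure_mul_setLAverage (f := σ) hVt', hQc']
    exact ENNReal.mul_ne_top (volume_cube_ne_top _ _)
      (hw.setLAverage_rpow_ne_top hp hM _ (by positivity))
  set I := ∫⁻ y in Q, F y with hI_def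
  have hIν : I = ∫⁻ y in Q, F y / σ y ∂ν := by
    rw [restrict_withDensity hQm, show (fun y => F y / σ y) = F / σ from rfl,
      lintegral_withDensity_eq_lintegral_mul _ hσm (hF.div hσm)]
    refine lintegral_congr_ae ?_
    filter_upwards [ae_restrict_of_ae hσ.ae_ne] with y hy
    rw [Pi.mul_apply]
    exact (ENNReal.mul_div_cancel hy.1 hy.2).symm
  have hG : ∀ y ∈ Q, I / ν Q' ≤ G y := by
    intro y hy
    refine le_trans (ENNReal.div_le_div ?_ ?_) (le_centMax ν _ y (k + 1))
    · rw [hIν]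
      refine lintegral_mono_set (closedBall_subset_closedBall' ?_)
      rw [dist_comm, hk1]
      linarith [mem_closedBall.1 hy]
    · refine measure_mono (closedBall_subset_closedBall' ?_)
      rw [hk1, hk2]
      linarith [mem_closedBall.1 hy]
  have hInt : (I / ν Q') ^ (p - 1) * volume Q ≤ μ Q * centMax μ H x := by
    calc (I / ν Q') ^ (p - 1) * volume Q = ∫⁻ _ in Q, (I / ν Q') ^ (p - 1) := by simp
      _ ≤ ∫⁻ y in Q, G y ^ (p - 1) :=
          setLIntegral_mono (hGm.pow_const _) fun y hy => by gcongr; exact hG y hy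
      _ = ∫⁻ y in Q, H y ∂μ := by
          rw [restrict_withDensity hQm, lintegral_withDensity_eq_lintegral_mul _ hwm hHm]
          refine lintegral_congr_ae ?_
          filter_upwards [ae_restrict_of_ae hw.ae_ne] with y hy
          rw [Pi.mul_apply]
          exact (ENNReal.mul_div_cancel hy.1 hy.2).symm
      _ = μ Q * ((∫⁻ y in Q, H y ∂μ) / μ Q) := (ENNReal.mul_div_cancel hμ0 hμt).symm
      _ ≤ _ := by gcongr; exact le_centMax μ H x k
  have hVp : volume Q ^ p = volume Q * volume Q ^ (p - 1) := by
    conv_lhs => rw [show p = 1 + (p - 1) by ring]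
    rw [ENNReal.rpow_add _ _ hV0 hVt, ENNReal.rpow_one]
  have hVp0 : volume Q ^ p ≠ 0 := (ENNReal.rpow_pos (pos_iff_ne_zero.2 hV0) hVt).ne'
  have hVpt : volume Q ^ p ≠ ∞ := ENNReal.rpow_ne_top_of_nonneg (by linarith) hVt
  have hsplit : (I / volume Q) ^ (p - 1) * volume Q ^ p =
      (I / ν Q') ^ (p - 1) * volume Q * ν Q' ^ (p - 1) := by
    have e1 : (I / volume Q) ^ (p - 1) * volume Q ^ (p - 1) = I ^ (p - 1) := by
      rw [← ENNReal.mul_rpow_of_nonneg _ _ hp1.le, ENNReal.div_mul_cancel hV0 hVt]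
    have e2 : (I / ν Q') ^ (p - 1) * ν Q' ^ (p - 1) = I ^ (p - 1) := by
      rw [← ENNReal.mul_rpow_of_nonneg _ _ hp1.le, ENNReal.div_mul_cancel hν0 hνt]
    calc _ = volume Q * ((I / volume Q) ^ (p - 1) * volume Q ^ (p - 1)) := by rw [hVp]; ring
      _ = volume Q * ((I / ν Q') ^ (p - 1) * ν Q' ^ (p - 1)) := by rw [e1, e2]
      _ = _ := by ring
  refine (ENNReal.mul_le_mul_iff_left hVp0 hVpt).1 ?_
  calc (I / volume Q) ^ (p - 1) * volume Q ^ p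
      = (I / ν Q') ^ (p - 1) * volume Q * ν Q' ^ (p - 1) := hsplit
    _ ≤ μ Q * centMax μ H x * ν Q' ^ (p - 1) := by gcongr
    _ = μ Q * ν Q' ^ (p - 1) * centMax μ H x := by ring
    _ ≤ apE p w * ((4 : ℝ≥0∞) ^ n) ^ p * volume Q ^ p * centMax μ H x := by gcongr
    _ = _ := by ring

/-- Muckenhoupt's theorem: the maximal operator is bounded on `L^p(w)` for `w ∈ A_p`, with a bound
that is uniform over weights of bounded characteristic. -/
lemma exists_centMax_weighted_bound (n : ℕ) {p : ℝ} (hp : 1 < p) {M : ℝ≥0∞} (hM : M ≠ ∞) :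
    ∃ A : ℝ≥0∞, A ≠ ∞ ∧ ∀ w : (Fin n → ℝ) → ℝ≥0∞, IsWeight w → apE p w ≤ M →
      ∀ F : (Fin n → ℝ) → ℝ≥0∞, Measurable F →
        ∫⁻ x, centMax volume F x ^ p * w x ≤ A * ∫⁻ x, F x ^ p * w x := by
  have hp0 : 0 < p := by linarith
  have hp1 : 0 < p - 1 := by linarith
  have hq : 1 < p / (p - 1) := by rw [lt_div_iff₀ hp1]; linarith
  obtain ⟨K, hK, hKb⟩ := exists_centMax_strong_type n hp
  obtain ⟨K', hK', hKb'⟩ := exists_centMax_strong_type n hq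
  refine ⟨(M * ((4 : ℝ≥0∞) ^ n) ^ p) ^ (p / (p - 1)) * (K' * K), ?_, ?_⟩
  · refine ENNReal.mul_ne_top (ENNReal.rpow_ne_top_of_nonneg (by linarith)
      (ENNReal.mul_ne_top hM (ENNReal.rpow_ne_top_of_nonneg hp0.le (by finiteness))))
      (ENNReal.mul_ne_top hK' hK)
  suffices h : ∀ w : (Fin n → ℝ) → ℝ≥0∞, Measurable w → IsWeight w → apE p w ≤ M →
      ∀ F : (Fin n → ℝ) → ℝ≥0∞, Measurable F → ∫⁻ x, centMax volume F x ^ p * w x ≤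
        (M * ((4 : ℝ≥0∞) ^ n) ^ p) ^ (p / (p - 1)) * (K' * K) * ∫⁻ x, F x ^ p * w x by
    intro w hw hwM F hF
    have hae := hw.aemeasurable.ae_eq_mk
    have hcongr : ∀ G : (Fin n → ℝ) → ℝ≥0∞,
        ∫⁻ x, G x * w x = ∫⁻ x, G x * hw.aemeasurable.mk w x := fun G =>
      lintegral_congr_ae (by filter_upwards [hae] with x hx; rw [hx])
    rw [hcongr, hcongr]
    refine h _ hw.aemeasurable.measurable_mk ⟨hw.aemeasurable.measurable_mk.aemeasurable, ?_⟩
      ((apE_congr hae).symm.trans_le hwM) F hF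
    filter_upwards [hae, hw.ae_ne] with x hx h1
    rwa [← hx]
  intro w hwm hw hwM F hF
  have hMw : apE p w ≠ ∞ := ne_top_of_le_ne_top hM hwM
  set σ : (Fin n → ℝ) → ℝ≥0∞ := fun z => w z ^ (-(1 / (p - 1))) with hσ_def
  have hσm : Measurable σ := hwm.pow_const _
  have hσ : IsWeight σ := hw.rpow _
  set G := centMax (volume.withDensity σ) (fun z => F z / σ z) with hG_def
  have hGm : Measurable G := measurable_centMax _ (hF.div hσm)
  set H : (Fin n → ℝ) → ℝ≥0∞ := fun y => G y ^ (p - 1) / w y with hH_def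
  have hHm : Measurable H := (hGm.pow_const _).div hwm
  set B := M * ((4 : ℝ≥0∞) ^ n) ^ p
  have hpt : ∀ x, centMax volume F x ^ p ≤
      B ^ (p / (p - 1)) * centMax (volume.withDensity w) H x ^ (p / (p - 1)) := by
    intro x
    rw [← ENNReal.mul_rpow_of_nonneg _ _ (by linarith : 0 ≤ p / (p - 1))]
    conv_lhs => rw [show p = (p - 1) * (p / (p - 1)) by field_simp, ENNReal.rpow_mul]
    gcongr
    exact (centMax_volume_rpow_le hp hwm hw hMw hF x).trans (by gcongr; exact mul_le_mul_left hwM _)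
  have hB : B ^ (p / (p - 1)) ≠ ∞ := ENNReal.rpow_ne_top_of_nonneg (by linarith)
    (ENNReal.mul_ne_top hM (ENNReal.rpow_ne_top_of_nonneg hp0.le (by finiteness)))
  have hwd : ∀ {v f : (Fin n → ℝ) → ℝ≥0∞}, Measurable v → Measurable f →
      ∫⁻ x, f x ∂(volume.withDensity v) = ∫⁻ x, f x * v x := by
    intro v f hv hf
    rw [lintegral_withDensity_eq_lintegral_mul _ hv hf]
    exact lintegral_congr fun x => mul_comm _ _
  calc ∫⁻ x, centMax volume F x ^ p * w x
      ≤ ∫⁻ x, B ^ (p / (p - 1)) *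
          (centMax (volume.withDensity w) H x ^ (p / (p - 1)) * w x) := by
        refine lintegral_mono fun x => ?_
        rw [← mul_assoc]
        gcongr
        exact hpt x
    _ = B ^ (p / (p - 1)) *
          ∫⁻ x, centMax (volume.withDensity w) H x ^ (p / (p - 1)) ∂(volume.withDensity w) := by
        rw [lintegral_const_mul' _ _ hB, hwd hwm ((measurable_centMax _ hHm).pow_const _)]
    _ ≤ B ^ (p / (p - 1)) * (K' * ∫⁻ x, H x ^ (p / (p - 1)) ∂(volume.withDensity w)) := by
        gcongr
        exact hKb' _ H hHm
    _ = B ^ (p / (p - 1)) * (K' * ∫⁻ x, G x ^ p ∂(volume.withDensity σ)) := by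
        rw [hwd hwm (hHm.pow_const _), hwd hσm (hGm.pow_const _)]
        congr 2
        refine lintegral_congr_ae ?_
        filter_upwards [hw.ae_ne] with x hx
        simp only [hH_def, hσ_def]
        rw [ENNReal.div_rpow_of_nonneg _ _ (by linarith : 0 ≤ p / (p - 1)), ← ENNReal.rpow_mul,
          show (p - 1) * (p / (p - 1)) = p by field_simp, div_eq_mul_inv, ← ENNReal.rpow_neg,
          mul_assoc]
        congr 1
        nth_rewrite 2 [← ENNReal.rpow_one (w x)]
        rw [← ENNReal.rpow_add _ _ hx.1 hx.2]
        congr 1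
        field_simp
        ring
    _ ≤ B ^ (p / (p - 1)) * (K' * (K * ∫⁻ x, (F x / σ x) ^ p ∂(volume.withDensity σ))) := by
        gcongr
        exact hKb _ _ (hF.div hσm)
    _ = B ^ (p / (p - 1)) * (K' * (K * ∫⁻ x, F x ^ p * w x)) := by
        rw [hwd (f := fun x => (F x / σ x) ^ p) hσm ((hF.div hσm).pow_const _)]
        congr 3
        refine lintegral_congr_ae ?_
        filter_upwards [hw.ae_ne] with x hx
        simp only [hσ_def]
        rw [ENNReal.div_rpow_of_nonneg _ _ hp0.le, div_eq_mul_inv, ← ENNReal.rpow_mul,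
          ← ENNReal.rpow_neg, mul_assoc, ← ENNReal.rpow_add _ _ hx.1 hx.2]
        conv_rhs => rw [← ENNReal.rpow_one (w x)]
        congr 2
        field_simp
        ring
    _ = _ := by ring

/-! ### The Rubio de Francia algorithm -/

lemma centMax_volume_ne_zero {F : (Fin n → ℝ) → ℝ≥0∞} (hF : ∫⁻ y, F y ≠ 0) (x : Fin n → ℝ) :
    centMax volume F x ≠ 0 := by
  intro h
  apply hF
  have hball : ∀ k : ℕ, ∫⁻ y in closedBall x ((2 : ℝ) ^ (k : ℤ)), F y = 0 := by
    intro k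
    have h1 := le_centMax volume F x k
    rw [h, nonpos_iff_eq_zero, ENNReal.div_eq_zero_iff] at h1
    refine h1.resolve_right ?_
    rw [closedBall_eq_cube x (by positivity)]
    exact volume_cube_ne_top _ _
  have hU : (⋃ k : ℕ, closedBall x ((2 : ℝ) ^ (k : ℤ))) = univ := by
    refine eq_univ_of_forall fun y => ?_
    obtain ⟨k, hk⟩ := pow_unbounded_of_one_lt (dist y x) (one_lt_two (α := ℝ))
    exact mem_iUnion.2 ⟨k, by rw [mem_closedBall, zpow_natCast]; exact hk.le⟩
  rw [← setLIntegral_univ, ← hU, ← nonpos_iff_eq_zero]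
  refine (lintegral_iUnion_le _ _).trans ?_
  simp only [hball, tsum_zero, le_refl]

/-- Averages over arbitrary cubes are controlled by the centred maximal function at each point of
the cube. -/
lemma setLAverage_cube_le_centMax (F : (Fin n → ℝ) → ℝ≥0∞) (a : Fin n → ℝ) {ℓ : ℝ} (hℓ : 0 < ℓ)
    {x : Fin n → ℝ} (hx : x ∈ cube a ℓ) :
    ⨍⁻ y in cube a ℓ, F y ∂volume ≤ 4 ^ n * centMax volume F x := by
  obtain ⟨k, hk1, hk2⟩ := exists_mem_Ioc_zpow hℓ (one_lt_two (α := ℝ))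
  refine le_trans ?_ (mul_le_mul_right (le_centMax volume F x (k + 1)) _)
  set B := closedBall x ((2 : ℝ) ^ (k + 1)) with hB
  have hBc : B = cube (fun i => x i - 2 ^ (k + 1)) (2 * 2 ^ (k + 1)) :=
    closedBall_eq_cube x (by positivity)
  have hvol : volume B ≤ 4 ^ n * volume (cube a ℓ) := by
    rw [hBc, volume_cube, volume_cube, ← mul_pow]
    gcongr
    rw [← ENNReal.ofReal_ofNat 4, ← ENNReal.ofReal_mul (by norm_num)]
    refine ENNReal.ofReal_le_ofReal ?_
    rw [zpow_add₀ two_ne_zero, zpow_one]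
    linarith
  have hB0 : volume B ≠ 0 := by rw [hBc]; exact volume_cube_ne_zero _ (by positivity)
  have hBt : volume B ≠ ∞ := by rw [hBc]; exact volume_cube_ne_top _ _
  rw [setLAverage_eq, ENNReal.div_le_iff (volume_cube_ne_zero a hℓ) (volume_cube_ne_top a ℓ)]
  calc ∫⁻ y in cube a ℓ, F y ≤ ∫⁻ y in B, F y :=
        lintegral_mono_set (cube_subset_closedBall hk2 (by positivity) hx)
    _ = (∫⁻ y in B, F y) / volume B * volume B := (ENNReal.div_mul_cancel hB0 hBt).symm
    _ ≤ (∫⁻ y in B, F y) / volume B * (4 ^ n * volume (cube a ℓ)) := by gcongr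
    _ = _ := by ring

/-- Partial iterates of the Rubio de Francia algorithm, `S₀ = 0` and `Sᵢ₊₁ = F + ε M Sᵢ`. -/
noncomputable def rdfIter (ε : ℝ≥0∞) (F : (Fin n → ℝ) → ℝ≥0∞) : ℕ → (Fin n → ℝ) → ℝ≥0∞
  | 0 => 0
  | i + 1 => fun x => F x + ε * centMax volume (rdfIter ε F i) x

lemma measurable_rdfIter (ε : ℝ≥0∞) {F : (Fin n → ℝ) → ℝ≥0∞} (hF : Measurable F) (i : ℕ) :
    Measurable (rdfIter ε F i) := by
  induction i with
  | zero => exact measurable_zero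
  | succ i ih => exact hF.add ((measurable_centMax volume ih).const_mul ε)

lemma rdfIter_mono (ε : ℝ≥0∞) (F : (Fin n → ℝ) → ℝ≥0∞) : Monotone (rdfIter ε F) := by
  refine monotone_nat_of_le_succ fun i => ?_
  induction i with
  | zero => exact fun x => zero_le
  | succ i ih =>
    intro x
    exact add_le_add le_rfl (mul_le_mul_right (centMax_mono ih x) ε)

/-- The limit `U` of the Rubio de Francia algorithm, the least solution of `U = F + ε M U`. -/
noncomputable def rdf (ε : ℝ≥0∞) (F : (Fin n → ℝ) → ℝ≥0∞) (x : Fin n → ℝ) : ℝ≥0∞ :=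
  ⨆ i, rdfIter ε F i x

lemma rdf_eq (ε : ℝ≥0∞) {F : (Fin n → ℝ) → ℝ≥0∞} (hF : Measurable F) (x : Fin n → ℝ) :
    rdf ε F x = F x + ε * centMax volume (rdf ε F) x := by
  have h1 : centMax volume (rdf ε F) x = ⨆ i, centMax volume (rdfIter ε F i) x :=
    centMax_iSup volume (measurable_rdfIter ε hF) (rdfIter_mono ε F) x
  have h2 : rdf ε F x = ⨆ i, rdfIter ε F (i + 1) x :=
    (Monotone.iSup_nat_add (fun i j hij => rdfIter_mono ε F hij x) 1).symm
  rw [h1, h2, ENNReal.mul_iSup, ENNReal.add_iSup]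
  rfl

/-- Rubio de Francia algorithm: every nonzero function in `L^b(w)`, `w ∈ A_b`, has a majorant
of comparable norm that satisfies an `A_1` condition. The estimates depend on the weight only
through a bound for its characteristic. -/
lemma exists_A1_majorant (n : ℕ) {b : ℝ} (hb : 1 < b) {M : ℝ≥0∞} (hM : M ≠ ∞) :
    ∃ A : ℝ≥0∞, A ≠ ∞ ∧ ∀ w : (Fin n → ℝ) → ℝ≥0∞, IsWeight w → apE b w ≤ M →
      ∀ F : (Fin n → ℝ) → ℝ≥0∞, AEMeasurable F → ¬ F =ᵐ[volume] 0 →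
        ∃ U : (Fin n → ℝ) → ℝ≥0∞, Measurable U ∧ F ≤ᵐ[volume] U ∧ (∀ x, U x ≠ 0) ∧
          ∫⁻ x, U x ^ b * w x ≤ 2 ^ b * ∫⁻ x, F x ^ b * w x ∧
          ∀ (a : Fin n → ℝ) (ℓ : ℝ), 0 < ℓ → ∀ x ∈ cube a ℓ,
            ⨍⁻ y in cube a ℓ, U y ∂volume ≤ A * U x := by
  have hb0 : 0 < b := by linarith
  obtain ⟨K, hK, hKb⟩ := exists_centMax_weighted_bound n hb hM
  -- The parameter `ε` is chosen so that `ε M` has norm at most `1 / 2` on `L^b(w)`.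
  set c : ℝ≥0∞ := 2 * (max K 1) ^ (1 / b) with hc
  have hK1t : max K 1 ≠ ∞ := by simp [hK]
  have hK10 : max K 1 ≠ 0 := (lt_max_of_lt_right one_pos).ne'
  have hc0 : c ≠ 0 := mul_ne_zero two_ne_zero (ENNReal.rpow_pos (pos_iff_ne_zero.2 hK10) hK1t).ne'
  have hct : c ≠ ∞ := ENNReal.mul_ne_top (by finiteness)
    (ENNReal.rpow_ne_top_of_nonneg (by positivity) hK1t)
  have hcb : c⁻¹ ^ b * K * 2 ^ b ≤ 1 := by
    have : c ^ b = 2 ^ b * max K 1 := by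
      rw [hc, ENNReal.mul_rpow_of_nonneg _ _ hb0.le, ← ENNReal.rpow_mul,
        show 1 / b * b = 1 by field_simp, ENNReal.rpow_one]
    rw [ENNReal.inv_rpow, mul_assoc, mul_comm, ← div_eq_mul_inv]
    refine ENNReal.div_le_of_le_mul ?_
    rw [this, one_mul, mul_comm]
    gcongr
    exact le_max_left _ _
  refine ⟨4 ^ n * c, ENNReal.mul_ne_top (by finiteness) hct, ?_⟩
  intro w hw hwM F₀ hF₀ hne
  set F := hF₀.mk F₀ with hF_def
  have hF : Measurable F := hF₀.measurable_mk
  have hFF : F₀ =ᵐ[volume] F := hF₀.ae_eq_mk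
  have hFint : ∫⁻ x, F x ≠ 0 := by
    intro h
    rw [lintegral_eq_zero_iff hF] at h
    exact hne (hFF.trans h)
  have hUeq := rdf_eq c⁻¹ hF
  have hUm : Measurable (rdf c⁻¹ F) := Measurable.iSup (measurable_rdfIter c⁻¹ hF)
  have hFU : F ≤ rdf c⁻¹ F := fun x => by rw [hUeq]; exact le_self_add
  have hMU : ∀ x, centMax volume (rdf c⁻¹ F) x ≤ c * rdf c⁻¹ F x := by
    intro x
    calc centMax volume (rdf c⁻¹ F) x = c * (c⁻¹ * centMax volume (rdf c⁻¹ F) x) := by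
          rw [← mul_assoc, ENNReal.mul_inv_cancel hc0 hct, one_mul]
      _ ≤ c * rdf c⁻¹ F x := by
          gcongr
          conv_rhs => rw [hUeq]
          exact le_add_self
  have hint : ∫⁻ x, F₀ x ^ b * w x = ∫⁻ x, F x ^ b * w x :=
    lintegral_congr_ae (by filter_upwards [hFF] with x hx; rw [hx])
  refine ⟨rdf c⁻¹ F, hUm, ?_, ?_, ?_, ?_⟩
  · filter_upwards [hFF] with x hx
    rw [hx]
    exact hFU x
  · intro x h
    have h1 := hMU x
    rw [h, mul_zero, nonpos_iff_eq_zero] at h1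
    refine centMax_volume_ne_zero (fun h2 => hFint ?_) x h1
    exact nonpos_iff_eq_zero.1 ((lintegral_mono hFU).trans h2.le)
  · rw [hint]
    have hiter : ∀ i, ∫⁻ x, rdfIter c⁻¹ F i x ^ b * w x ≤ 2 ^ b * ∫⁻ x, F x ^ b * w x := by
      intro i
      induction i with
      | zero => simp [rdfIter, hb0]
      | succ i ih =>
        set S := rdfIter c⁻¹ F i with hS
        have hSm : Measurable S := measurable_rdfIter c⁻¹ hF i
        have hcinv : c⁻¹ ^ b ≠ ∞ :=
          ENNReal.rpow_ne_top_of_nonneg hb0.le (ENNReal.inv_ne_top.2 hc0)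
        have h2 : (2 : ℝ≥0∞) ^ (b - 1) ≠ ∞ :=
          ENNReal.rpow_ne_top_of_nonneg (by linarith) (by finiteness)
        calc ∫⁻ x, (F x + c⁻¹ * centMax volume S x) ^ b * w x
            ≤ ∫⁻ x, 2 ^ (b - 1) * (F x ^ b * w x + c⁻¹ ^ b * (centMax volume S x ^ b * w x)) := by
              refine lintegral_mono fun x => ?_
              calc _ ≤ 2 ^ (b - 1) * (F x ^ b + (c⁻¹ * centMax volume S x) ^ b) * w x := by
                    gcongr
                    exact ENNReal.rpow_add_le_mul_rpow_add_rpow _ _ hb.le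
                _ = _ := by
                    rw [ENNReal.mul_rpow_of_nonneg _ _ hb0.le]
                    ring
          _ = 2 ^ (b - 1) * ((∫⁻ x, F x ^ b * w x) +
                c⁻¹ ^ b * ∫⁻ x, centMax volume S x ^ b * w x) := by
              have hFw : AEMeasurable fun x => F x ^ b * w x :=
                (hF.pow_const b).aemeasurable.mul hw.aemeasurable
              rw [lintegral_const_mul' _ _ h2, lintegral_add_left' hFw,
                lintegral_const_mul' _ _ hcinv]
          _ ≤ 2 ^ (b - 1) * ((∫⁻ x, F x ^ b * w x) +
                c⁻¹ ^ b * (K * (2 ^ b * ∫⁻ x, F x ^ b * w x))) := by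
              refine mul_le_mul_right (add_le_add le_rfl (mul_le_mul_right ?_ _)) _
              exact (hKb w hw hwM S hSm).trans (mul_le_mul_right ih _)
          _ = 2 ^ (b - 1) * ((∫⁻ x, F x ^ b * w x) +
                c⁻¹ ^ b * K * 2 ^ b * ∫⁻ x, F x ^ b * w x) := by ring
          _ ≤ 2 ^ (b - 1) * ((∫⁻ x, F x ^ b * w x) + 1 * ∫⁻ x, F x ^ b * w x) := by gcongr
          _ = 2 ^ (b - 1) * 2 * ∫⁻ x, F x ^ b * w x := by ring
          _ = 2 ^ b * ∫⁻ x, F x ^ b * w x := by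
              congr 1
              nth_rewrite 2 [← ENNReal.rpow_one 2]
              rw [← ENNReal.rpow_add _ _ two_ne_zero (by finiteness)]
              congr 1
              ring
    have hsup : ∀ x, rdf c⁻¹ F x ^ b * w x = ⨆ i, rdfIter c⁻¹ F i x ^ b * w x := by
      intro x
      rw [← ENNReal.iSup_mul]
      congr 1
      exact (ENNReal.orderIsoRpow b hb0).map_iSup _
    simp_rw [hsup]
    rw [lintegral_iSup']
    · exact iSup_le hiter
    · exact fun i => ((measurable_rdfIter c⁻¹ hF i).pow_const b).aemeasurable.mul hw.aemeasurable
    · refine Filter.Eventually.of_forall fun x i j hij => ?_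
      exact mul_le_mul_left (ENNReal.rpow_le_rpow (rdfIter_mono c⁻¹ F hij x) hb0.le) _
  · intro a ℓ hℓ x hx
    rw [mul_assoc]
    exact (setLAverage_cube_le_centMax _ a hℓ hx).trans (mul_le_mul_right (hMU x) _)

/-! ### Weights built from an `A_1` factor -/

/-- If `w ∈ A_b`, `U ∈ A_1` and `b < a`, then `w U ^ (b - a) ∈ A_a`. -/
lemma apE_mul_rpow_neg_le {a b : ℝ} (hb : 1 < b) (hab : b < a) {w U : (Fin n → ℝ) → ℝ≥0∞}
    (hw : IsWeight w) (hU : IsWeight U) {A : ℝ≥0∞} (hA : A ≠ ∞)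
    (hA1 : ∀ (c : Fin n → ℝ) (ℓ : ℝ), 0 < ℓ → ∀ x ∈ cube c ℓ,
      ⨍⁻ y in cube c ℓ, U y ∂volume ≤ A * U x) :
    apE a (fun x => w x * U x ^ (-(a - b))) ≤ A ^ (a - b) * apE b w := by
  have hab0 : 0 < a - b := by linarith
  have ha1 : 0 < a - 1 := by linarith
  have hb1 : 0 < b - 1 := by linarith
  refine iSup_le fun c => iSup_le fun ℓ => iSup_le fun hℓ => ?_
  set Q := cube c ℓ with hQ
  have hQm : MeasurableSet Q := measurableSet_cube c ℓ
  set m := ⨍⁻ y in Q, U y ∂volume with hm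
  have hm0 : m ≠ 0 := hU.setLAverage_ne_zero c hℓ
  have hmt : m ≠ ∞ := by
    have hex : ∃ x ∈ Q, U x ≠ ∞ := by
      by_contra! hcon
      have h1 : volume Q = 0 := by
        refine measure_mono_null (fun x hx => ?_) (ae_iff.1 hU.ae_ne)
        exact fun h => h.2 (hcon x hx)
      exact volume_cube_ne_zero c hℓ h1
    obtain ⟨x, hx, hUx⟩ := hex
    exact ne_top_of_le_ne_top (ENNReal.mul_ne_top hA hUx) (hA1 c ℓ hℓ x hx)
  have hfirst : ⨍⁻ x in Q, w x * U x ^ (-(a - b)) ∂volume ≤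
      (⨍⁻ x in Q, w x ∂volume) * (A / m) ^ (a - b) := by
    rw [setLAverage_eq, setLAverage_eq, div_eq_mul_inv, div_eq_mul_inv, mul_right_comm,
      ← lintegral_mul_const' _ _ (ENNReal.rpow_ne_top_of_nonneg hab0.le (ENNReal.div_ne_top hA hm0))]
    refine mul_le_mul_left (setLIntegral_mono_ae' hQm (Filter.Eventually.of_forall
      fun x hx => ?_)) _
    rw [ENNReal.rpow_neg, ← ENNReal.inv_rpow]
    gcongr
    rw [ENNReal.le_div_iff_mul_le (Or.inl hm0) (Or.inl hmt), mul_comm, ← div_eq_mul_inv]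
    exact ENNReal.div_le_of_le_mul (hA1 c ℓ hℓ x hx)
  have hsecond : ⨍⁻ x in Q, (w x * U x ^ (-(a - b))) ^ (-(1 / (a - 1))) ∂volume ≤
      (⨍⁻ x in Q, w x ^ (-(1 / (b - 1))) ∂volume) ^ ((b - 1) / (a - 1)) *
        m ^ ((a - b) / (a - 1)) := by
    have hc : ⨍⁻ x in Q, (w x * U x ^ (-(a - b))) ^ (-(1 / (a - 1))) ∂volume =
        ⨍⁻ x in Q, (w x ^ (-(1 / (b - 1)))) ^ ((b - 1) / (a - 1)) *
          U x ^ ((a - b) / (a - 1)) ∂volume := by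
      refine laverage_congr (ae_restrict_of_ae ?_)
      filter_upwards [hw.ae_ne, (hU.rpow (-(a - b))).ae_ne] with x h1 h2
      rw [ENNReal.mul_rpow_of_ne_zero h1.1 h2.1, ← ENNReal.rpow_mul, ← ENNReal.rpow_mul]
      congr 2 <;> field_simp
    rw [hc]
    exact ENNReal.lintegral_mul_norm_pow_le
      ((hw.rpow _).aemeasurable.restrict.smul_measure _) (hU.aemeasurable.restrict.smul_measure _)
      (by positivity) (by positivity) (by field_simp; ring)
  calc _ ≤ (⨍⁻ x in Q, w x ∂volume) * (A / m) ^ (a - b) *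
        ((⨍⁻ x in Q, w x ^ (-(1 / (b - 1))) ∂volume) ^ ((b - 1) / (a - 1)) *
        m ^ ((a - b) / (a - 1))) ^ (a - 1) := by gcongr
    _ = (⨍⁻ x in Q, w x ∂volume) * (A / m) ^ (a - b) *
        ((⨍⁻ x in Q, w x ^ (-(1 / (b - 1))) ∂volume) ^ (b - 1) * m ^ (a - b)) := by
        rw [ENNReal.mul_rpow_of_nonneg _ _ ha1.le, ← ENNReal.rpow_mul, ← ENNReal.rpow_mul,
          div_mul_cancel₀ _ ha1.ne', div_mul_cancel₀ _ ha1.ne']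
    _ = (A / m * m) ^ (a - b) * ((⨍⁻ x in Q, w x ∂volume) *
        (⨍⁻ x in Q, w x ^ (-(1 / (b - 1))) ∂volume) ^ (b - 1)) := by
        rw [ENNReal.mul_rpow_of_nonneg _ _ hab0.le]
        ring
    _ ≤ A ^ (a - b) * apE b w := by
        rw [ENNReal.div_mul_cancel hm0 hmt]
        gcongr
        exact le_apE b w c hℓ

/-! ### One-variable off-diagonal extrapolation -/

/-- The quantity `(∫ F ^ q) ^ (1 / q)` for a function with values in `[0, ∞]`. -/
noncomputable def lnorm (q : ℝ) (F : (Fin n → ℝ) → ℝ≥0∞) : ℝ≥0∞ := (∫⁻ x, F x ^ q) ^ (1 / q)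

/-- The one-variable hypothesis `‖h v^{1/a}‖_{L^p} ≤ C ‖f v^{1/a}‖_{L^a}` for all weights `v` with
`A_a` characteristic at most `N`. Writing the weights as multipliers, rather than as measures, lets
the exponents on the two sides vary independently. -/
def NormBound (a p : ℝ) (N C : ℝ≥0∞) (h f : (Fin n → ℝ) → ℝ≥0∞) : Prop :=
  ∀ v : (Fin n → ℝ) → ℝ≥0∞, IsWeight v → apE a v ≤ N →
    lnorm p (fun x => h x * v x ^ (1 / a)) ≤ C * lnorm a (fun x => f x * v x ^ (1 / a))

lemma lnorm_congr {q : ℝ} {F G : (Fin n → ℝ) → ℝ≥0∞} (h : F =ᵐ[volume] G) :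
    lnorm q F = lnorm q G := by
  unfold lnorm
  congr 1
  exact lintegral_congr_ae (by filter_upwards [h] with x hx; rw [hx])

lemma lnorm_mul_le {p q r : ℝ} (hp : 0 < p) (hpq : p < q) (hpqr : 1 / p = 1 / q + 1 / r)
    {F G : (Fin n → ℝ) → ℝ≥0∞} (hF : AEMeasurable F) (hG : AEMeasurable G) :
    lnorm p (fun x => F x * G x) ≤ lnorm q F * lnorm r G :=
  ENNReal.lintegral_Lp_mul_le_Lq_mul_Lr hp hpq hpqr volume hF hG

lemma mul_rpow_one_div_rpow (x y : ℝ≥0∞) {q : ℝ} (hq : 0 < q) :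
    (x * y ^ (1 / q)) ^ q = x ^ q * y := by
  rw [ENNReal.mul_rpow_of_nonneg _ _ hq.le, ← ENNReal.rpow_mul, one_div_mul_cancel hq.ne',
    ENNReal.rpow_one]

/-- Lowering the exponent: `b < a`. The hypothesis is applied to the weight `w U ^ (b - a)`, with
`U` the Rubio de Francia majorant of `f` in `L^b(w)`. -/
lemma exists_normBound_of_lt (n : ℕ) {a b p s : ℝ} (hb : 1 < b) (hab : b < a) (hp : 0 < p)
    (hs : 0 < s) (hps : 1 / s = 1 / p + (1 / b - 1 / a)) {M : ℝ≥0∞} (hM : M ≠ ∞) :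
    ∃ N k : ℝ≥0∞, N ≠ ∞ ∧ k ≠ 0 ∧ k ≠ ∞ ∧ ∀ (h f : (Fin n → ℝ) → ℝ≥0∞) (C : ℝ≥0∞),
      AEMeasurable h → AEMeasurable f → ¬ f =ᵐ[volume] 0 → C ≠ 0 → NormBound a p N C h f →
        NormBound b s M (k * C) h f := by
  obtain ⟨A, hA, hmaj⟩ := exists_A1_majorant n hb hM
  have hb0 : 0 < b := by linarith
  have ha0 : 0 < a := by linarith
  have hab0 : 0 < a - b := by linarith
  refine ⟨A ^ (a - b) * M, 2, ENNReal.mul_ne_top (ENNReal.rpow_ne_top_of_nonneg hab0.le hA) hM,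
    two_ne_zero, by finiteness, fun h f C hh hf hf0 hC H w hw hwM => ?_⟩
  set J := ∫⁻ x, f x ^ b * w x with hJ
  have hL : lnorm b (fun x => f x * w x ^ (1 / b)) = J ^ (1 / b) := by
    simp only [lnorm, mul_rpow_one_div_rpow _ _ hb0, hJ]
  rw [hL]
  by_cases hJt : J = ∞
  · rw [hJt, ENNReal.top_rpow_of_pos (by positivity), ENNReal.mul_top (mul_ne_zero two_ne_zero hC)]
    exact le_top
  obtain ⟨U, hUm, hfU, hU0, hUJ, hUA⟩ := hmaj w hw hwM f hf hf0
  set T := ∫⁻ x, U x ^ b * w x with hT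
  have hTt : T ≠ ∞ := ne_top_of_le_ne_top
    (ENNReal.mul_ne_top (ENNReal.rpow_ne_top_of_nonneg hb0.le (by finiteness)) hJt) hUJ
  have hU : IsWeight U := by
    refine ⟨hUm.aemeasurable, ?_⟩
    filter_upwards [ae_lt_top' ((hUm.pow_const b).aemeasurable.mul hw.aemeasurable) hTt, hw.ae_ne]
      with x hx hwx
    refine ⟨hU0 x, fun hxt => ?_⟩
    rw [Pi.mul_apply, hxt, ENNReal.top_rpow_of_pos hb0, ENNReal.top_mul hwx.1] at hx
    exact lt_irrefl _ hx
  set v : (Fin n → ℝ) → ℝ≥0∞ := fun x => w x * U x ^ (-(a - b)) with hv_def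
  have hv : IsWeight v := hw.mul (hU.rpow _)
  have hvN : apE a v ≤ A ^ (a - b) * M :=
    (apE_mul_rpow_neg_le hb hab hw hU hA hUA).trans (by gcongr)
  set r := a * b / (a - b) with hr
  have hr0 : 0 < r := by positivity
  have hr1 : 1 / r = 1 / b - 1 / a := by rw [hr]; field_simp
  set W : (Fin n → ℝ) → ℝ≥0∞ := fun x => (U x ^ b * w x) ^ (1 / r) with hW
  have hWm : AEMeasurable W :=
    ((hUm.pow_const b).aemeasurable.mul hw.aemeasurable).pow_const _
  have hsplit : (fun x => h x * w x ^ (1 / b)) =ᵐ[volume]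
      fun x => h x * v x ^ (1 / a) * W x := by
    filter_upwards [hw.ae_ne, hU.ae_ne] with x h1 h2
    have h3 : U x ^ (-(a - b)) ≠ 0 := (ENNReal.rpow_pos (pos_iff_ne_zero.2 h2.1) h2.2).ne'
    rw [mul_assoc]
    congr 1
    simp only [hv_def, hW]
    rw [ENNReal.mul_rpow_of_ne_zero h1.1 h3,
      ENNReal.mul_rpow_of_nonneg _ _ (by positivity : 0 ≤ 1 / r), ← ENNReal.rpow_mul,
      ← ENNReal.rpow_mul]
    calc w x ^ (1 / b) = w x ^ (1 / a + 1 / r) * U x ^ (-(a - b) * (1 / a) + b * (1 / r)) := by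
          rw [hr1, show 1 / a + (1 / b - 1 / a) = 1 / b by ring,
            show -(a - b) * (1 / a) + b * (1 / b - 1 / a) = 0 by field_simp; ring,
            ENNReal.rpow_zero, mul_one]
      _ = _ := by
          rw [ENNReal.rpow_add _ _ h1.1 h1.2, ENNReal.rpow_add _ _ h2.1 h2.2]
          ring
  have hWn : lnorm r W = T ^ (1 / r) := by
    simp only [lnorm, hW]
    congr 1
    refine lintegral_congr fun x => ?_
    rw [← ENNReal.rpow_mul, one_div_mul_cancel hr0.ne', ENNReal.rpow_one]
  have hfv : lnorm a (fun x => f x * v x ^ (1 / a)) ≤ T ^ (1 / a) := by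
    simp only [lnorm, mul_rpow_one_div_rpow _ _ ha0]
    refine ENNReal.rpow_le_rpow (lintegral_mono_ae ?_) (by positivity)
    filter_upwards [hfU, hU.ae_ne] with x h1 h2
    calc f x ^ a * v x ≤ U x ^ a * (w x * U x ^ (-(a - b))) := by gcongr
      _ = U x ^ (a + -(a - b)) * w x := by
          rw [ENNReal.rpow_add _ _ h2.1 h2.2]
          ring
      _ = U x ^ b * w x := by ring_nf
  have hsp : s < p := by
    have h1 : 1 / p < 1 / s := by
      rw [hps, ← hr1]
      linarith [show 0 < 1 / r by positivity]
    exact (one_div_lt_one_div hp hs).1 h1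
  calc lnorm s (fun x => h x * w x ^ (1 / b))
      = lnorm s (fun x => h x * v x ^ (1 / a) * W x) := lnorm_congr hsplit
    _ ≤ lnorm p (fun x => h x * v x ^ (1 / a)) * lnorm r W :=
        lnorm_mul_le hs hsp (by rw [hr1, hps]) (hh.mul (hv.rpow _).aemeasurable) hWm
    _ ≤ C * T ^ (1 / a) * T ^ (1 / r) := by
        rw [hWn]
        gcongr
        exact (H v hv hvN).trans (by gcongr)
    _ = C * T ^ (1 / b) := by
        rw [mul_assoc, ← ENNReal.rpow_add_of_nonneg _ _ (by positivity) (by positivity), hr1]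
        congr 2
        ring
    _ ≤ C * (2 ^ b * J) ^ (1 / b) := by gcongr
    _ = 2 * C * J ^ (1 / b) := by
        rw [ENNReal.mul_rpow_of_nonneg _ _ (by positivity), ← ENNReal.rpow_mul,
          mul_one_div_cancel hb0.ne', ENNReal.rpow_one]
        ring

lemma exists_le_lt_lintegral_of_lt_lintegral {α : Type*} [MeasurableSpace α] {μ : Measure α}
    [SigmaFinite μ] {f : α → ℝ≥0∞} {L : ℝ≥0∞} (hL : L < ∫⁻ x, f x ∂μ) :
    ∃ g : α → ℝ≥0∞, Measurable g ∧ g ≤ f ∧ ∫⁻ x, g x ∂μ ≠ ∞ ∧ L < ∫⁻ x, g x ∂μ := by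
  simp_rw [lintegral_eq_nnreal, lt_iSup_iff] at hL
  obtain ⟨g₀, hg₀, hL₀⟩ := hL
  rw [← SimpleFunc.lintegral_eq_lintegral] at hL₀
  obtain ⟨g, hg, hgt, hLg⟩ := SimpleFunc.exists_lt_lintegral_simpleFunc_of_lt_lintegral
    (f := g₀) hL₀
  exact ⟨fun x => g x, g.measurable.coe_nnreal_ennreal,
    fun x => (ENNReal.coe_le_coe.2 (hg x)).trans (hg₀ x), hgt.ne, hLg⟩

/-- Raising the exponent: `a < b`. Since `1 / p - 1 / s = 1 / a - 1 / b > 0`, the norm in `L^s` is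
recovered by duality from norms in `L^p`; the dual function is majorized by the
Rubio de Francia algorithm in `L^{b'}(σ)`, where `σ = w ^ (-1 / (b - 1))` is the dual weight. -/
lemma exists_normBound_of_gt (n : ℕ) {a b p s : ℝ} (ha : 1 < a) (hab : a < b) (hp : 0 < p)
    (hs : 0 < s) (hps : 1 / p = 1 / s + (1 / a - 1 / b)) {M : ℝ≥0∞} (hM : M ≠ ∞) :
    ∃ N k : ℝ≥0∞, N ≠ ∞ ∧ k ≠ 0 ∧ k ≠ ∞ ∧ ∀ (h f : (Fin n → ℝ) → ℝ≥0∞) (C : ℝ≥0∞),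
      AEMeasurable h → AEMeasurable f → NormBound a p N C h f →
        NormBound b s M (k * C) h f := by
  have ha0 : 0 < a := by linarith
  have ha1 : 0 < a - 1 := by linarith
  have hb : 1 < b := by linarith
  have hb0 : 0 < b := by linarith
  have hb1 : 0 < b - 1 := by linarith
  have hba : 0 < b - a := by linarith
  set a' := a / (a - 1) with ha'
  set b' := b / (b - 1) with hb'
  have hb'1 : 1 < b' := by rw [hb', lt_div_iff₀ hb1]; linarith
  have hb'0 : 0 < b' := by linarith
  have hab' : b' < a' := by
    rw [ha', hb', div_lt_div_iff₀ hb1 ha1]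
    linarith
  have ha'1 : 1 < a' := by linarith
  have e1 : 1 / (a' - 1) = a - 1 := by rw [ha']; field_simp; ring
  have e2 : a' / (a' - 1) = a := by
    rw [div_eq_mul_one_div, e1, ha']
    field_simp
  have hM' : M ^ (1 / (b - 1)) ≠ ∞ := ENNReal.rpow_ne_top_of_nonneg (by positivity) hM
  obtain ⟨A, hA, hmaj⟩ := exists_A1_majorant n hb'1 hM'
  set r := a * b / (b - a) with hr
  have hr0 : 0 < r := by positivity
  have hr1 : 1 / r = 1 / a - 1 / b := by rw [hr]; field_simp
  have h2b : (2 : ℝ≥0∞) ^ b' ≠ ∞ := ENNReal.rpow_ne_top_of_nonneg hb'0.le (by finiteness)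
  have h2b0 : (2 : ℝ≥0∞) ^ b' ≠ 0 := (ENNReal.rpow_pos two_pos (by finiteness)).ne'
  refine ⟨(A ^ (a' - b') * M ^ (1 / (b - 1))) ^ (a - 1), ((2 : ℝ≥0∞) ^ b') ^ (1 / r), ?_, ?_, ?_,
    fun h f C hh hf H w hw hwM => ?_⟩
  · exact ENNReal.rpow_ne_top_of_nonneg ha1.le
      (ENNReal.mul_ne_top (ENNReal.rpow_ne_top_of_nonneg (by linarith) hA) hM')
  · exact (ENNReal.rpow_pos (pos_iff_ne_zero.2 h2b0) h2b).ne'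
  · exact ENNReal.rpow_ne_top_of_nonneg (by positivity) h2b
  set L := lnorm b (fun x => f x * w x ^ (1 / b)) with hL
  set σ : (Fin n → ℝ) → ℝ≥0∞ := fun x => w x ^ (-(1 / (b - 1))) with hσ_def
  have hσ : IsWeight σ := hw.rpow _
  have hσM : apE b' σ ≤ M ^ (1 / (b - 1)) := (apE_dual_le hb w).trans (by gcongr)
  set Hs : (Fin n → ℝ) → ℝ≥0∞ := fun x => h x * w x ^ (1 / b) with hHs
  rw [lnorm, one_div, ENNReal.rpow_inv_le_iff hs]
  refine le_of_forall_lt fun y hy => ?_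
  obtain ⟨g, hgm, hgH, hgt, hyg⟩ := exists_le_lt_lintegral_of_lt_lintegral hy
  set I := ∫⁻ x, g x with hI
  have hI0 : I ≠ 0 := (pos_of_gt hyg).ne'
  -- The function to be majorized, normalized so that `F ^ b' * σ = g`.
  set F : (Fin n → ℝ) → ℝ≥0∞ := fun x => (g x / σ x) ^ (1 / b') with hF_def
  have hFm : AEMeasurable F := (hgm.aemeasurable.div hσ.aemeasurable).pow_const _
  have hFσ : ∀ᵐ x, F x ^ b' * σ x = g x := by
    filter_upwards [hσ.ae_ne] with x hx
    rw [hF_def, ← ENNReal.rpow_mul, one_div_mul_cancel hb'0.ne', ENNReal.rpow_one,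
      ENNReal.div_mul_cancel hx.1 hx.2]
  have hFI : ∫⁻ x, F x ^ b' * σ x = I := lintegral_congr_ae hFσ
  have hF0 : ¬ F =ᵐ[volume] 0 := by
    intro h0
    apply hI0
    rw [← hFI, ← lintegral_zero (α := Fin n → ℝ) (μ := volume)]
    refine lintegral_congr_ae ?_
    filter_upwards [h0] with x hx
    rw [hx, Pi.zero_apply, ENNReal.zero_rpow_of_pos hb'0, zero_mul]
  obtain ⟨U, hUm, hFU, hU0, hUI, hUA⟩ := hmaj σ hσ hσM F hFm hF0
  rw [hFI] at hUI
  set T := ∫⁻ x, U x ^ b' * σ x with hT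
  have hTt : T ≠ ∞ := ne_top_of_le_ne_top (ENNReal.mul_ne_top h2b hgt) hUI
  have hU : IsWeight U := by
    refine ⟨hUm.aemeasurable, ?_⟩
    filter_upwards [ae_lt_top' ((hUm.pow_const b').aemeasurable.mul hσ.aemeasurable) hTt, hσ.ae_ne]
      with x hx hσx
    refine ⟨hU0 x, fun hxt => ?_⟩
    rw [Pi.mul_apply, hxt, ENNReal.top_rpow_of_pos hb'0, ENNReal.top_mul hσx.1] at hx
    exact lt_irrefl _ hx
  set V : (Fin n → ℝ) → ℝ≥0∞ := fun x => σ x * U x ^ (-(a' - b')) with hV_def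
  have hV : IsWeight V := hσ.mul (hU.rpow _)
  have hVN : apE a' V ≤ A ^ (a' - b') * M ^ (1 / (b - 1)) :=
    (apE_mul_rpow_neg_le hb'1 hab' hσ hU hA hUA).trans (by gcongr)
  set v : (Fin n → ℝ) → ℝ≥0∞ := fun x => V x ^ (-(a - 1)) with hv_def
  have hv : IsWeight v := hV.rpow _
  have hvN : apE a v ≤ (A ^ (a' - b') * M ^ (1 / (b - 1))) ^ (a - 1) := by
    have h1 := apE_dual_le ha'1 V
    rw [e1, e2] at h1
    exact h1.trans (by gcongr)
  set K : (Fin n → ℝ) → ℝ≥0∞ := fun x => (U x ^ b' * σ x) ^ (1 / r) with hK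
  have hKm : AEMeasurable K :=
    ((hUm.pow_const b').aemeasurable.mul hσ.aemeasurable).pow_const _
  have hvK : ∀ᵐ x, v x ^ (1 / a) = w x ^ (1 / b) * K x := by
    filter_upwards [hw.ae_ne, hU.ae_ne, hσ.ae_ne, (hU.rpow (-(a' - b'))).ae_ne]
      with x h1 h2 h3 h4
    simp only [hv_def, hV_def, hK]
    rw [← ENNReal.rpow_mul, ENNReal.mul_rpow_of_ne_zero h3.1 h4.1,
      ENNReal.mul_rpow_of_nonneg _ _ (by positivity : 0 ≤ 1 / r)]
    calc _ = w x ^ (1 / b) * σ x ^ (1 / r) * (U x ^ b') ^ (1 / r) := by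
          congr 1
          · simp only [hσ_def]
            rw [← ENNReal.rpow_mul, ← ENNReal.rpow_mul, ← ENNReal.rpow_add _ _ h1.1 h1.2]
            congr 1
            rw [hr1]
            field_simp
            ring
          · rw [← ENNReal.rpow_mul, ← ENNReal.rpow_mul]
            congr 1
            rw [hr1, ha', hb']
            field_simp
            ring
      _ = _ := by ring
  have hKn : lnorm r K = T ^ (1 / r) := by
    simp only [lnorm, hK]
    congr 1
    refine lintegral_congr fun x => ?_
    rw [← ENNReal.rpow_mul, one_div_mul_cancel hr0.ne', ENNReal.rpow_one]
  have hlow : I ^ (1 / p) ≤ lnorm p (fun x => h x * v x ^ (1 / a)) := by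
    refine ENNReal.rpow_le_rpow (lintegral_mono_ae ?_) (by positivity)
    filter_upwards [hvK, hFσ, hFU] with x h1 h2 h3
    have h4 : g x ^ (1 / s) ≤ Hs x := by
      rw [one_div, ENNReal.rpow_inv_le_iff hs]
      exact hgH x
    have h5 : g x ^ (1 / r) ≤ K x := by
      rw [← h2]
      simp only [hK]
      gcongr
    calc g x = (g x ^ (1 / s) * g x ^ (1 / r)) ^ p := by
          rw [← ENNReal.rpow_add_of_nonneg _ _ (by positivity) (by positivity), hr1, ← hps,
            ← ENNReal.rpow_mul, one_div_mul_cancel hp.ne', ENNReal.rpow_one]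
      _ ≤ (Hs x * K x) ^ p := by gcongr
      _ = (h x * v x ^ (1 / a)) ^ p := by rw [h1, ← mul_assoc]
  have hupp : lnorm a (fun x => f x * v x ^ (1 / a)) ≤ L * T ^ (1 / r) := by
    rw [← hKn]
    have h1 : (fun x => f x * v x ^ (1 / a)) =ᵐ[volume] fun x => f x * w x ^ (1 / b) * K x := by
      filter_upwards [hvK] with x hx
      rw [hx, mul_assoc]
    rw [lnorm_congr h1]
    exact lnorm_mul_le ha0 hab (by rw [hr1]; ring) (hf.mul (hw.rpow _).aemeasurable) hKm
  have hIr0 : I ^ (1 / r) ≠ 0 := (ENNReal.rpow_pos (pos_iff_ne_zero.2 hI0) hgt).ne'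
  have hIrt : I ^ (1 / r) ≠ ∞ := ENNReal.rpow_ne_top_of_nonneg (by positivity) hgt
  have hmain : I ^ (1 / s) ≤ ((2 : ℝ≥0∞) ^ b') ^ (1 / r) * C * L := by
    refine (ENNReal.mul_le_mul_iff_left hIr0 hIrt).1 ?_
    calc I ^ (1 / s) * I ^ (1 / r) = I ^ (1 / p) := by
          rw [← ENNReal.rpow_add_of_nonneg _ _ (by positivity) (by positivity), hr1, ← hps]
      _ ≤ C * (L * T ^ (1 / r)) := hlow.trans ((H v hv hvN).trans (by gcongr))
      _ ≤ C * (L * (2 ^ b' * I) ^ (1 / r)) := by gcongr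
      _ = _ := by
          rw [ENNReal.mul_rpow_of_nonneg _ _ (by positivity)]
          ring
  rw [one_div, ENNReal.rpow_inv_le_iff hs] at hmain
  exact hyg.trans_le hmain

/-- One-variable extrapolation with an arbitrary gap `1 / p - 1 / a = 1 / s - 1 / b` between the
exponents on the two sides; the target exponent `s` may be smaller than `1`. -/
lemma exists_normBound (n : ℕ) {a b p s : ℝ} (ha : 1 < a) (hb : 1 < b) (hp : 0 < p)
    (hs : 0 < s) (hps : 1 / p - 1 / a = 1 / s - 1 / b) {M : ℝ≥0∞} (hM : M ≠ ∞) :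
    ∃ N k : ℝ≥0∞, N ≠ ∞ ∧ k ≠ 0 ∧ k ≠ ∞ ∧ ∀ (h f : (Fin n → ℝ) → ℝ≥0∞) (C : ℝ≥0∞),
      AEMeasurable h → AEMeasurable f → ¬ f =ᵐ[volume] 0 → C ≠ 0 → NormBound a p N C h f →
        NormBound b s M (k * C) h f := by
  rcases lt_trichotomy a b with hab | rfl | hab
  · obtain ⟨N, k, hN, hk0, hk, H⟩ :=
      exists_normBound_of_gt n ha hab hp hs (by linarith) hM
    exact ⟨N, k, hN, hk0, hk, fun h f C hh hf _ _ => H h f C hh hf⟩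
  · have : p = s := by
      have h1 : 1 / p = 1 / s := by linarith
      simpa using h1
    subst this
    exact ⟨M, 1, hM, one_ne_zero, ENNReal.one_ne_top, fun h f C _ _ _ _ H => by rwa [one_mul]⟩
  · exact exists_normBound_of_lt n hb hab hp hs (by linarith) hM

/-! ### Passing between real and extended weights -/

lemma IsApWeight.isWeight {r : ℝ} {w : (Fin n → ℝ) → ℝ} (hw : IsApWeight r w) :
    IsWeight fun x => ENNReal.ofReal (w x) where
  aemeasurable := hw.locallyIntegrable.aestronglyMeasurable.aemeasurable.ennreal_ofReal
  ae_ne := by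
    filter_upwards [hw.pos] with x hx
    exact ⟨by simpa using hx, ENNReal.ofReal_ne_top⟩

lemma IsWeight.ofReal_toReal_ae_eq {w : (Fin n → ℝ) → ℝ≥0∞} (hw : IsWeight w) :
    (fun x => ENNReal.ofReal (w x).toReal) =ᵐ[volume] w := by
  filter_upwards [hw.ae_ne] with x hx using ENNReal.ofReal_toReal hx.2

lemma IsWeight.apConst_toReal {w : (Fin n → ℝ) → ℝ≥0∞} (hw : IsWeight w) (r : ℝ) :
    apConst r (fun x => (w x).toReal) = apE r w :=
  apE_congr hw.ofReal_toReal_ae_eq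

lemma IsWeight.isApWeight_toReal {w : (Fin n → ℝ) → ℝ≥0∞} (hw : IsWeight w) {r : ℝ} (hr : 1 < r)
    (h : apE r w ≠ ∞) : IsApWeight r fun x => (w x).toReal where
  locallyIntegrable := by
    intro x
    refine ⟨closedBall x 1, closedBall_mem_nhds x one_pos, ?_⟩
    refine integrable_toReal_of_lintegral_ne_top hw.aemeasurable.restrict ?_
    rw [closedBall_eq_cube x zero_le_one, ← measure_mul_setLAverage (f := w)
      (volume_cube_ne_top _ _)]
    exact ENNReal.mul_ne_top (volume_cube_ne_top _ _)
      (hw.setLAverage_ne_top hr h _ (by norm_num))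
  pos := by
    filter_upwards [hw.ae_ne] with x hx using ENNReal.toReal_pos hx.1 hx.2
  apConst_lt_top := by
    rw [hw.apConst_toReal]
    exact h.lt_top

lemma isWeight_one : IsWeight (fun _ : Fin n → ℝ => (1 : ℝ≥0∞)) where
  aemeasurable := aemeasurable_const
  ae_ne := by simp

lemma apE_one_le (r : ℝ) : apE r (fun _ : Fin n → ℝ => (1 : ℝ≥0∞)) ≤ 1 := by
  refine iSup_le fun a => iSup_le fun ℓ => iSup_le fun hℓ => ?_
  simp only [ENNReal.one_rpow]
  rw [setLAverage_one (volume_cube_ne_zero a hℓ) (volume_cube_ne_top a ℓ), ENNReal.one_rpow,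
    one_mul]

lemma weightedNorm_eq_lnorm {r : ℝ} (hr : 0 < r) {w : (Fin n → ℝ) → ℝ} (hw : AEMeasurable w)
    {f : (Fin n → ℝ) → ℂ} (hf : AEMeasurable f) :
    weightedNorm r w f = lnorm r fun x => ‖f x‖ₑ * ENNReal.ofReal (w x) ^ (1 / r) := by
  rw [weightedNorm, eLpNorm_eq_lintegral_rpow_enorm_toReal (by simpa using hr)
    ENNReal.ofReal_ne_top, ENNReal.toReal_ofReal hr.le, lnorm,
    lintegral_withDensity_eq_lintegral_mul₀ hw.ennreal_ofReal (hf.enorm.pow_const r)]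
  simp only [mul_rpow_one_div_rpow _ _ hr, Pi.mul_apply, mul_comm]

/-- The product weight `u₁ ^ (p / p₁) u₂ ^ (p / p₂)` as a pair of multipliers. -/
lemma weightedNorm_prod_eq_lnorm {p p₁ p₂ : ℝ} (hp : 0 < p) {u₁ u₂ : (Fin n → ℝ) → ℝ}
    (hu₁ : AEMeasurable u₁) (hu₂ : AEMeasurable u₂) (h₁ : ∀ᵐ x, 0 < u₁ x) (h₂ : ∀ᵐ x, 0 < u₂ x)
    {g : (Fin n → ℝ) → ℂ} (hg : AEMeasurable g) :
    weightedNorm p (fun x => u₁ x ^ (p / p₁) * u₂ x ^ (p / p₂)) g =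
      lnorm p fun x => ‖g x‖ₑ * ENNReal.ofReal (u₂ x) ^ (1 / p₂) *
        ENNReal.ofReal (u₁ x) ^ (1 / p₁) := by
  have hu : AEMeasurable fun x => u₁ x ^ (p / p₁) * u₂ x ^ (p / p₂) :=
    (hu₁.pow_const _).mul (hu₂.pow_const _)
  rw [weightedNorm_eq_lnorm hp hu hg]
  refine lnorm_congr ?_
  filter_upwards [h₁, h₂] with x hx₁ hx₂
  have e₁ : ENNReal.ofReal (u₁ x) ≠ 0 := by simpa using hx₁
  have e₂ : ENNReal.ofReal (u₂ x) ≠ 0 := by simpa using hx₂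
  rw [ENNReal.ofReal_mul (by positivity), ← ENNReal.ofReal_rpow_of_pos hx₁,
    ← ENNReal.ofReal_rpow_of_pos hx₂, ENNReal.mul_rpow_of_nonneg _ _ (by positivity),
    ← ENNReal.rpow_mul, ← ENNReal.rpow_mul, show p / p₁ * (1 / p) = 1 / p₁ by field_simp,
    show p / p₂ * (1 / p) = 1 / p₂ by field_simp]
  ring

lemma lnorm_mul_rpow_eq_zero_iff {q s : ℝ} (hq : 0 < q) {F w : (Fin n → ℝ) → ℝ≥0∞}
    (hF : AEMeasurable F) (hw : IsWeight w) :
    lnorm q (fun x => F x * w x ^ s) = 0 ↔ F =ᵐ[volume] 0 := by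
  have hm : AEMeasurable fun x => (F x * w x ^ s) ^ q :=
    (hF.mul (hw.rpow s).aemeasurable).pow_const q
  rw [lnorm, ENNReal.rpow_eq_zero_iff_of_pos (by positivity), lintegral_eq_zero_iff' hm]
  refine Filter.eventually_congr ?_
  filter_upwards [(hw.rpow s).ae_ne] with x hx
  simp [ENNReal.rpow_eq_zero_iff_of_pos hq, hx.1]

lemma lnorm_of_ae_eq_zero {q : ℝ} (hq : 0 < q) {F : (Fin n → ℝ) → ℝ≥0∞} (hF : F =ᵐ[volume] 0) :
    lnorm q F = 0 := by
  rw [lnorm_congr hF]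
  simp [lnorm, hq]

/-! ### Extrapolation in two variables -/

/-- `StrongBound` in terms of extended weights, with the constant made uniform over weights of
bounded characteristic. -/
def PairBound (p₁ p₂ p : ℝ) (N₁ N₂ C : ℝ≥0∞) (f₁ f₂ g : (Fin n → ℝ) → ℝ≥0∞) : Prop :=
  ∀ v₁ v₂ : (Fin n → ℝ) → ℝ≥0∞, IsWeight v₁ → IsWeight v₂ → apE p₁ v₁ ≤ N₁ → apE p₂ v₂ ≤ N₂ →
    lnorm p (fun x => g x * v₂ x ^ (1 / p₂) * v₁ x ^ (1 / p₁)) ≤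
      C * lnorm p₁ (fun x => f₁ x * v₁ x ^ (1 / p₁)) * lnorm p₂ (fun x => f₂ x * v₂ x ^ (1 / p₂))

/-- Extrapolation in one variable at a time, the weight of the other variable being frozen and
absorbed into `g`. -/
lemma exists_pairBound (n : ℕ) {p₁ p₂ p q₁ q₂ q : ℝ} (hp₁ : 1 < p₁) (hp₂ : 1 < p₂)
    (hp : 1 / p₁ + 1 / p₂ = 1 / p) (hq₁ : 1 < q₁) (hq₂ : 1 < q₂) (hq : 1 / q₁ + 1 / q₂ = 1 / q)
    {M : ℝ≥0∞} (hM : M ≠ ∞) :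
    ∃ N₁ N₂ k : ℝ≥0∞, N₁ ≠ ∞ ∧ N₂ ≠ ∞ ∧ k ≠ ∞ ∧
      ∀ (f₁ f₂ g : (Fin n → ℝ) → ℝ≥0∞) (C : ℝ≥0∞), AEMeasurable f₁ → AEMeasurable f₂ →
        AEMeasurable g → C ≠ 0 → PairBound p₁ p₂ p N₁ N₂ C f₁ f₂ g →
          PairBound q₁ q₂ q M M (k * C) f₁ f₂ g := by
  have hp0 : 0 < p := one_div_pos.1 (by rw [← hp]; positivity)
  have hq0 : 0 < q := one_div_pos.1 (by rw [← hq]; positivity)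
  -- The intermediate exponent, after the first variable has been moved.
  set s : ℝ := (1 / q₁ + 1 / p₂)⁻¹ with hs
  have hs0 : 0 < s := by positivity
  have hs1 : 1 / s = 1 / q₁ + 1 / p₂ := by rw [hs, one_div, inv_inv]
  obtain ⟨N₁, k₁, hN₁, hk₁0, hk₁, H₁⟩ := exists_normBound n hp₁ hq₁ hp0 hs0 (by linarith) hM
  obtain ⟨N₂, k₂, hN₂, hk₂0, hk₂, H₂⟩ := exists_normBound n hp₂ hq₂ hs0 hq0 (by linarith) hM
  -- The constant weight has to be admissible, to see that `g` vanishes when `f₁` or `f₂` does.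
  refine ⟨max N₁ 1, max N₂ 1, k₂ * k₁, by simp [hN₁], by simp [hN₂], ENNReal.mul_ne_top hk₂ hk₁,
    fun f₁ f₂ g C hf₁ hf₂ hg hC H => ?_⟩
  intro w₁ w₂ hw₁ hw₂ hwM₁ hwM₂
  by_cases h0 : f₁ =ᵐ[volume] 0 ∨ f₂ =ᵐ[volume] 0
  · have h1 := H _ _ isWeight_one isWeight_one ((apE_one_le p₁).trans (le_max_right _ _))
      ((apE_one_le p₂).trans (le_max_right _ _))
    have hz : C * lnorm p₁ (fun x => f₁ x * (1 : ℝ≥0∞) ^ (1 / p₁)) *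
        lnorm p₂ (fun x => f₂ x * (1 : ℝ≥0∞) ^ (1 / p₂)) = 0 := by
      rcases h0 with h0 | h0
      · rw [(lnorm_mul_rpow_eq_zero_iff (by linarith) hf₁ isWeight_one).2 h0, mul_zero, zero_mul]
      · rw [(lnorm_mul_rpow_eq_zero_iff (by linarith) hf₂ isWeight_one).2 h0, mul_zero]
    have hg1 : AEMeasurable fun x => g x * (1 : ℝ≥0∞) ^ (1 / p₂) :=
      hg.mul (isWeight_one.rpow _).aemeasurable
    rw [hz, nonpos_iff_eq_zero, lnorm_mul_rpow_eq_zero_iff hp0 hg1 isWeight_one] at h1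
    rw [lnorm_of_ae_eq_zero hq0]
    · exact zero_le
    filter_upwards [h1] with x hx
    have : g x = 0 := by simpa using hx
    simp [this]
  · push Not at h0
    set L₁ := lnorm q₁ (fun x => f₁ x * w₁ x ^ (1 / q₁)) with hL₁
    have hL₁0 : L₁ ≠ 0 := fun h =>
      h0.1 ((lnorm_mul_rpow_eq_zero_iff (by linarith) hf₁ hw₁).1 h)
    have step : NormBound p₂ s N₂ (k₁ * C * L₁) (fun x => g x * w₁ x ^ (1 / q₁)) f₂ := by
      intro v₂ hv₂ hv₂N
      set L₂ := lnorm p₂ (fun x => f₂ x * v₂ x ^ (1 / p₂)) with hL₂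
      have hL₂0 : L₂ ≠ 0 := fun h =>
        h0.2 ((lnorm_mul_rpow_eq_zero_iff (by linarith) hf₂ hv₂).1 h)
      have h1 : NormBound p₁ p N₁ (C * L₂) (fun x => g x * v₂ x ^ (1 / p₂)) f₁ := by
        intro v₁ hv₁ hv₁N
        refine (H v₁ v₂ hv₁ hv₂ (hv₁N.trans (le_max_left _ _))
          (hv₂N.trans (le_max_left _ _))).trans_eq ?_
        ring
      have h2 := H₁ _ f₁ (C * L₂) (hg.mul (hv₂.rpow _).aemeasurable) hf₁ h0.1
        (mul_ne_zero hC hL₂0) h1 w₁ hw₁ hwM₁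
      calc lnorm s (fun x => g x * w₁ x ^ (1 / q₁) * v₂ x ^ (1 / p₂))
          = lnorm s (fun x => g x * v₂ x ^ (1 / p₂) * w₁ x ^ (1 / q₁)) := by
            simp only [mul_right_comm]
        _ ≤ k₁ * (C * L₂) * L₁ := h2
        _ = k₁ * C * L₁ * L₂ := by ring
    have h3 := H₂ _ f₂ _ (hg.mul (hw₁.rpow _).aemeasurable) hf₂ h0.2
      (mul_ne_zero (mul_ne_zero hk₁0 hC) hL₁0) step w₂ hw₂ hwM₂
    calc lnorm q (fun x => g x * w₂ x ^ (1 / q₂) * w₁ x ^ (1 / q₁))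
        = lnorm q (fun x => g x * w₁ x ^ (1 / q₁) * w₂ x ^ (1 / q₂)) := by
          simp only [mul_right_comm]
      _ ≤ k₂ * (k₁ * C * L₁) * lnorm q₂ (fun x => f₂ x * w₂ x ^ (1 / q₂)) := h3
      _ = _ := by ring

lemma StrongBound.pairBound {p₁ p₂ p : ℝ} (hp₁ : 1 < p₁) (hp₂ : 1 < p₂) (hp : 0 < p)
    {φ : ℝ≥0 → ℝ≥0 → ℝ≥0} {f₁ f₂ g : (Fin n → ℝ) → ℂ} (hf₁ : AEMeasurable f₁)
    (hf₂ : AEMeasurable f₂) (hg : AEMeasurable g) (H : StrongBound p₁ p₂ p φ f₁ f₂ g)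
    {N₁ N₂ : ℝ≥0∞} (hN₁ : N₁ ≠ ∞) (hN₂ : N₂ ≠ ∞) {C : ℝ≥0}
    (hC : ∀ s t : ℝ≥0, 0 < s → (s : ℝ≥0∞) ≤ N₁ → 0 < t → (t : ℝ≥0∞) ≤ N₂ → φ s t ≤ C) :
    PairBound p₁ p₂ p N₁ N₂ C (fun x => ‖f₁ x‖ₑ) (fun x => ‖f₂ x‖ₑ) (fun x => ‖g x‖ₑ) := by
  intro v₁ v₂ hv₁ hv₂ h₁ h₂
  have ht₁ : apE p₁ v₁ ≠ ∞ := ne_top_of_le_ne_top hN₁ h₁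
  have ht₂ : apE p₂ v₂ ≠ ∞ := ne_top_of_le_ne_top hN₂ h₂
  have hw₁ := hv₁.isApWeight_toReal hp₁ ht₁
  have hw₂ := hv₂.isApWeight_toReal hp₂ ht₂
  have hm₁ : AEMeasurable fun x => (v₁ x).toReal := hv₁.aemeasurable.ennreal_toReal
  have hm₂ : AEMeasurable fun x => (v₂ x).toReal := hv₂.aemeasurable.ennreal_toReal
  have h := H _ _ hw₁ hw₂
  rw [weightedNorm_prod_eq_lnorm hp hm₁ hm₂ hw₁.pos hw₂.pos hg,
    weightedNorm_eq_lnorm (by linarith) hm₁ hf₁, weightedNorm_eq_lnorm (by linarith) hm₂ hf₂,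
    hv₁.apConst_toReal, hv₂.apConst_toReal] at h
  have e₁ : (fun x => ‖f₁ x‖ₑ * ENNReal.ofReal (v₁ x).toReal ^ (1 / p₁)) =ᵐ[volume]
      fun x => ‖f₁ x‖ₑ * v₁ x ^ (1 / p₁) := by
    filter_upwards [hv₁.ofReal_toReal_ae_eq] with x hx
    rw [hx]
  have e₂ : (fun x => ‖f₂ x‖ₑ * ENNReal.ofReal (v₂ x).toReal ^ (1 / p₂)) =ᵐ[volume]
      fun x => ‖f₂ x‖ₑ * v₂ x ^ (1 / p₂) := by
    filter_upwards [hv₂.ofReal_toReal_ae_eq] with x hx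
    rw [hx]
  have e₃ : (fun x => ‖g x‖ₑ * ENNReal.ofReal (v₂ x).toReal ^ (1 / p₂) *
      ENNReal.ofReal (v₁ x).toReal ^ (1 / p₁)) =ᵐ[volume]
      fun x => ‖g x‖ₑ * v₂ x ^ (1 / p₂) * v₁ x ^ (1 / p₁) := by
    filter_upwards [hv₁.ofReal_toReal_ae_eq, hv₂.ofReal_toReal_ae_eq] with x hx₁ hx₂
    rw [hx₁, hx₂]
  rw [lnorm_congr e₁, lnorm_congr e₂, lnorm_congr e₃] at h
  refine h.trans ?_
  gcongr
  exact hC _ _ (ENNReal.toNNReal_pos (hv₁.apE_ne_zero hp₁) ht₁)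
    (by rwa [ENNReal.coe_toNNReal ht₁])
    (ENNReal.toNNReal_pos (hv₂.apE_ne_zero hp₂) ht₂) (by rwa [ENNReal.coe_toNNReal ht₂])

lemma PairBound.weightedNorm_le {q₁ q₂ q : ℝ} (hq₁ : 0 < q₁) (hq₂ : 0 < q₂) (hq : 0 < q)
    {f₁ f₂ g : (Fin n → ℝ) → ℂ} (hf₁ : AEMeasurable f₁) (hf₂ : AEMeasurable f₂)
    (hg : AEMeasurable g) {M₁ M₂ C : ℝ≥0∞}
    (H : PairBound q₁ q₂ q M₁ M₂ C (fun x => ‖f₁ x‖ₑ) (fun x => ‖f₂ x‖ₑ) (fun x => ‖g x‖ₑ))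
    {w₁ w₂ : (Fin n → ℝ) → ℝ} (hw₁ : IsApWeight q₁ w₁) (hw₂ : IsApWeight q₂ w₂)
    (h₁ : apConst q₁ w₁ ≤ M₁) (h₂ : apConst q₂ w₂ ≤ M₂) :
    weightedNorm q (fun x => w₁ x ^ (q / q₁) * w₂ x ^ (q / q₂)) g ≤
      C * weightedNorm q₁ w₁ f₁ * weightedNorm q₂ w₂ f₂ := by
  have hm₁ : AEMeasurable w₁ := hw₁.locallyIntegrable.aestronglyMeasurable.aemeasurable
  have hm₂ : AEMeasurable w₂ := hw₂.locallyIntegrable.aestronglyMeasurable.aemeasurable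
  rw [weightedNorm_prod_eq_lnorm hq hm₁ hm₂ hw₁.pos hw₂.pos hg,
    weightedNorm_eq_lnorm hq₁ hm₁ hf₁, weightedNorm_eq_lnorm hq₂ hm₂ hf₂]
  exact H _ _ hw₁.isWeight hw₂.isWeight h₁ h₂

end MultExtrap

theorem theorem4p2 (n : ℕ) (p₁ p₂ p q₁ q₂ q : ℝ)
    (hp₁ : 1 < p₁) (hp₂ : 1 < p₂) (hp : 1 / p₁ + 1 / p₂ = 1 / p)
    (hq₁ : 1 < q₁) (hq₂ : 1 < q₂) (hq : 1 / q₁ + 1 / q₂ = 1 / q)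
    (φ : ℝ≥0 → ℝ≥0 → ℝ≥0) (hφ : MultExtrap.IsLocallyBounded φ) :
    ∃ Φ : ℝ≥0 → ℝ≥0 → ℝ≥0, MultExtrap.IsLocallyBounded Φ ∧
      ∀ f₁ f₂ g : (Fin n → ℝ) → ℂ,
        AEMeasurable f₁ → AEMeasurable f₂ → AEMeasurable g →
        MultExtrap.StrongBound p₁ p₂ p φ f₁ f₂ g →
        MultExtrap.StrongBound q₁ q₂ q Φ f₁ f₂ g := by
  have hp0 : 0 < p := one_div_pos.1 (by rw [← hp]; positivity)
  have hq0 : 0 < q := one_div_pos.1 (by rw [← hq]; positivity)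
  -- A uniform constant for all weights of characteristic at most `M`, for each natural number `M`.
  have key : ∀ M : ℕ, ∃ D : ℝ≥0, ∀ f₁ f₂ g : (Fin n → ℝ) → ℂ,
      AEMeasurable f₁ → AEMeasurable f₂ → AEMeasurable g →
      MultExtrap.StrongBound p₁ p₂ p φ f₁ f₂ g →
      MultExtrap.PairBound q₁ q₂ q M M D (fun x => ‖f₁ x‖ₑ) (fun x => ‖f₂ x‖ₑ)
        (fun x => ‖g x‖ₑ) := by
    intro M
    obtain ⟨N₁, N₂, k, hN₁, hN₂, hk, H⟩ := MultExtrap.exists_pairBound n hp₁ hp₂ hp hq₁ hq₂ hq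
      (ENNReal.natCast_ne_top M)
    lift N₁ to ℝ≥0 using hN₁
    lift N₂ to ℝ≥0 using hN₂
    lift k to ℝ≥0 using hk
    obtain ⟨C, hC⟩ := hφ (max N₁ N₂ + 1)
    refine ⟨k * max C 1, fun f₁ f₂ g hf₁ hf₂ hg hH => ?_⟩
    rw [ENNReal.coe_mul]
    refine H _ _ _ _ hf₁.enorm hf₂.enorm hg.enorm ?_
      (hH.pairBound hp₁ hp₂ hp0 hf₁ hf₂ hg ENNReal.coe_ne_top ENNReal.coe_ne_top ?_)
    · exact ENNReal.coe_ne_zero.2 (lt_max_of_lt_right one_pos).ne'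
    · intro s t hs hsN ht htN
      have h1 : s ≤ N₁ := ENNReal.coe_le_coe.1 hsN
      have h2 : t ≤ N₂ := ENNReal.coe_le_coe.1 htN
      refine (hC s t hs ?_ ht ?_).trans (le_max_left _ _)
      · exact (h1.trans (le_max_left _ _)).trans_lt (lt_add_one _)
      · exact (h2.trans (le_max_right _ _)).trans_lt (lt_add_one _)
  choose D hD using key
  refine ⟨fun s t => D ⌈max s t⌉₊, fun M => ?_, fun f₁ f₂ g hf₁ hf₂ hg H w₁ w₂ hw₁ hw₂ => ?_⟩
  · refine ⟨∑ i ∈ Finset.range (⌈M⌉₊ + 1), D i, fun s t _ hs _ ht => ?_⟩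
    refine Finset.single_le_sum (f := D) (fun i _ => zero_le) (Finset.mem_range.2 ?_)
    exact Nat.lt_succ_of_le (Nat.ceil_mono (max_lt hs ht).le)
  · set c₁ := (MultExtrap.apConst q₁ w₁).toNNReal with hc₁
    set c₂ := (MultExtrap.apConst q₂ w₂).toNNReal with hc₂
    have e₁ : MultExtrap.apConst q₁ w₁ = c₁ := (ENNReal.coe_toNNReal hw₁.apConst_lt_top.ne).symm
    have e₂ : MultExtrap.apConst q₂ w₂ = c₂ := (ENNReal.coe_toNNReal hw₂.apConst_lt_top.ne).symm
    have hle : max c₁ c₂ ≤ (⌈max c₁ c₂⌉₊ : ℝ≥0) := Nat.le_ceil _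
    refine (hD ⌈max c₁ c₂⌉₊ f₁ f₂ g hf₁ hf₂ hg H).weightedNorm_le (by linarith) (by linarith) hq0
      hf₁ hf₂ hg hw₁ hw₂ ?_ ?_
    · rw [e₁]
      exact_mod_cast (le_max_left _ _).trans hle
    · rw [e₂]
      exact_mod_cast (le_max_right _ _).trans hle
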